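/- **Setting.** Let $K$ be a nonempty poset. A $1$-simplex $b$ consists of faces $\partial_1 b,\partial_0 b\in K$ and a support $|b|\in K$ with $\partial_0 b,\partial_1 b\le |b|$; its opposite $\overline b$ has the faces exchanged. A $2$-simplex $c$ with vertices $x_0,x_1,x_2$ consists of $1$-simplices $\partial_2c:x_0\to x_1$, $\partial_0c:x_1\to x_2$, $\partial_1c:x_0\to x_2$ and a support in $K$ dominating their supports. A path $p:a\to o$ is a composable sequence $b_n*\cdots*b_1$ $(n\ge 1)$ of $1$-simplices from $a$ to $o$, with opposite $\overline p$; homotopy $\sim$ of paths is generated by replacing $\partial_0c*\partial_2c$ by $\partial_1c$. For $o\le a$, $(a,o)$ is the $1$-simplex $o\to a$ with support $a$. Assume that $K$ is pathwise connected; its fundamental group $\pi_1(K)$ is the group of homotopy classes of loops over a base point. A net of C*-algebras $(\mathcal A,\jmath)_K$ consists of unital C*-algebras $\mathcal A_o$ $(o\in K)$ and unital injective $*$-morphisms $\jmath_{oa}:\mathcal A_a\to\mathcal A_o$ $(a\le o)$ with $\jmath_{oa}\jmath_{ae}=\jmath_{oe}$; it is a net bundle if all $\jmath_{oa}$ are isomorphisms.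 Its enveloping net bundle $\overline{\mathcal A}$ has as fibre over $o$ the C*-completion of the unital $*$-algebra generated by symbols $(p,A)$, with $p:a\to o$ a path and $A\in\mathcal A_a$, subject to: $A\mapsto(p,A)$ is a unital $*$-homomorphism, $(p,\jmath_{\tilde a a}A)=(p*(\tilde a,a),A)$, and $(p,A)=(q,A)$ if $p\sim q$; the seminorm is $\|W\|=\sup_\pi\|\pi_o(W)\|$ over all morphisms $\pi$ of this bundle of $*$-algebras (inclusion maps $(p,A)\mapsto((\tilde o,o)*p,A)$) into C*-net bundles over $K$. The net is injective if $\overline{\mathcal A}\neq0$ and all canonical maps $A\mapsto(\iota_o,A)$, $\mathcal A_o\to\overline{\mathcal A}_o$, are injective, where $\iota_o$ is the trivial loop. Let $G$ be a group with an order preserving action on $K$. The net is $G$-covariant if it is given $*$-isomorphisms $\alpha^g_o:\mathcal A_o\to\mathcal A_{go}$ with $\alpha^h_{go}\alpha^g_o=\alpha^{hg}_o$ and $\alpha^g_o\jmath_{oa}=\jmath_{go\,ga}\alpha^g_a$. A $G$-covariant representation $(\pi,U,\Gamma)$ consists of Hilbert spaces $\mathcal H_o$, representations $\pi_o:\mathcal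 A_o\to\mathcal B(\mathcal H_o)$, and unitaries $U_{ao}:\mathcal H_o\to\mathcal H_a$ $(o\le a)$ and $\Gamma^g_o:\mathcal H_o\to\mathcal H_{go}$ such that $U_{ao}\pi_o(A)=\pi_a(\jmath_{ao}A)U_{ao}$, $U_{ea}U_{ao}=U_{eo}$, $\Gamma^h_{go}\Gamma^g_o=\Gamma^{hg}_o$, $\Gamma^g_o\pi_o(A)=\pi_{go}(\alpha^g_oA)\Gamma^g_o$ and $\Gamma^g_aU_{ao}=U_{ga\,go}\Gamma^g_o$. A topological group $G$ acting on $K$ as above is a continuous symmetry group if for every path $p:x\to y$ and all $a_0>y$, $a_1>x$ there is a neighbourhood of $e$ such that, for all $g$ in it, $gy\le a_0$, $gx\le a_1$ and $(a_0,gy)*gp*\overline{(a_1,gx)}\sim(a_0,y)*p*\overline{(a_1,x)}$. Then the action $\alpha$ is continuous if for all $o<a$ and $A\in\mathcal A_o$, as $g\to e$, eventually $go\le a$ and $\|\jmath_{a\,go}\alpha^g_o(A)-\jmath_{ao}(A)\|\to0$; and $\Gamma$ is strongly continuous if for all $o<a$ and $\Omega\in\mathcal H_o$, as $g\to e$, eventually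 $go\le a$ and $\|U_{a\,go}\Gamma^g_o\Omega-U_{ao}\Omega\|\to0$. **Proposition.** Let $K$ be a pathwise connected poset with amenable fundamental group, let $G$ be a group with an order preserving action on $K$, and let $(\mathcal A,\jmath,\alpha)_K$ be an injective $G$-covariant net of C*-algebras. (a) If $G$ is amenable (there is an invariant mean on the bounded functions on $G$), then the net has a $G$-covariant representation $(\pi,U,\Gamma)$ with all $\pi_o$ unital, on a nonzero Hilbert space $\mathcal H_o=\mathcal H$ not depending on $o$. (b) If $G$ is a topological group which is a continuous symmetry group of $K$ and is amenable as a topological group (there is a right invariant mean on the bounded functions $f$ on $G$ with $\sup_x|f(xv)-f(x)|\to0$ as $v\to e$), if $\alpha$ is continuous, and if $K$ has no maximal elements, then the net has a representation as in (a) for which $\Gamma$ is strongly continuous. -/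

import Mathlib

open scoped Topology

universe u v w

namespace PosetNet

section Paths

variable {K : Type v} [PartialOrder K]

/-- A singular 1-simplex `b` of the poset with faces `∂₁b = a`, `∂₀b = o`: it is determined by its
support `|b|`, an element of the poset dominating both faces. -/
structure OneSimplex (a o : K) where
  supp : K
  src_le : a ≤ supp
  tgt_le : o ≤ supp

namespace OneSimplex

/-- The opposite 1-simplex. -/
def opp {a o : K} (b : OneSimplex a o) : OneSimplex o a := ⟨b.supp, b.tgt_le, b.src_le⟩

/-- The degenerate 1-simplex over `o`. -/
def degen (o : K) : OneSimplex o o := ⟨o, le_rfl, le_rfl⟩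

/-- The 1-simplex `(ao)` of the nerve, with `∂₁ = o`, `∂₀ = a` and support `a`, for `o ≤ a`. -/
def nerve {o a : K} (h : o ≤ a) : OneSimplex o a := ⟨a, h, le_rfl⟩

end OneSimplex

/-- A singular 2-simplex `c` with vertices `x₀, x₁, x₂`; its faces are 1-simplices whose supports
lie below the support of `c`. -/
structure TwoSimplex (x₀ x₁ x₂ : K) where
  d₀ : OneSimplex x₁ x₂
  d₁ : OneSimplex x₀ x₂
  d₂ : OneSimplex x₀ x₁
  supp : K
  d₀_le : d₀.supp ≤ supp
  d₁_le : d₁.supp ≤ supp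
  d₂_le : d₂.supp ≤ supp

/-- `PosetPath a o` is the type of paths `bₙ * ⋯ * b₁ : a → o`, with `n ≥ 1`. -/
inductive PosetPath (a : K) : K → Type v
  | single {o : K} (b : OneSimplex a o) : PosetPath a o
  | cons {e o : K} (b : OneSimplex e o) (p : PosetPath a e) : PosetPath a o

namespace PosetPath

/-- The composition `q * p` (first `p`, then `q`). -/
def comp {a e : K} : {o : K} → PosetPath e o → PosetPath a e → PosetPath a o
  | _, single b, p => cons b p
  | _, cons b q, p => cons b (comp q p)

/-- The opposite path. -/
def rev {a : K} : {o : K} → PosetPath a o → PosetPath o a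
  | _, single b => single b.opp
  | _, cons b p => comp (rev p) (single b.opp)

/-- The trivial loop over `o`. -/
def triv (o : K) : PosetPath o o := single (OneSimplex.degen o)

/-- The path consisting of the 1-simplex of the nerve attached to `o ≤ a`. -/
def nerve {o a : K} (h : o ≤ a) : PosetPath o a := single (OneSimplex.nerve h)

/-- `Deform p q`: the path `q` is obtained from `p` by replacing two consecutive 1-simplices
`∂₀c * ∂₂c` by `∂₁c`, for a 2-simplex `c`. -/
inductive Deform : {a o : K} → PosetPath a o → PosetPath a o → Prop
  | last {x₀ x₁ x₂ : K} (c : TwoSimplex x₀ x₁ x₂) :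
      Deform (cons c.d₀ (single c.d₂)) (single c.d₁)
  | mid {a x₀ x₁ x₂ : K} (c : TwoSimplex x₀ x₁ x₂) (p : PosetPath a x₀) :
      Deform (cons c.d₀ (cons c.d₂ p)) (cons c.d₁ p)
  | cons {a e o : K} (b : OneSimplex e o) {p q : PosetPath a e} :
      Deform p q → Deform (cons b p) (cons b q)

/-- Homotopy of paths: a finite sequence of deformations and inverse deformations. -/
def Homotopic {a o : K} (p q : PosetPath a o) : Prop := Relation.EqvGen Deform p q

namespace Homotopic

theorem refl {a o : K} (p : PosetPath a o) : Homotopic p p := Relation.EqvGen.refl p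

theorem symm {a o : K} {p q : PosetPath a o} (h : Homotopic p q) : Homotopic q p :=
  Relation.EqvGen.symm _ _ h

theorem trans {a o : K} {p q r : PosetPath a o} (h : Homotopic p q) (h' : Homotopic q r) :
    Homotopic p r :=
  Relation.EqvGen.trans _ _ _ h h'

theorem cons {a e o : K} (b : OneSimplex e o) {p q : PosetPath a e} (h : Homotopic p q) :
    Homotopic (PosetPath.cons b p) (PosetPath.cons b q) := by
  induction h with
  | rel _ _ h => exact Relation.EqvGen.rel _ _ (Deform.cons b h)
  | refl _ => exact refl _
  | symm _ _ _ ih => exact ih.symm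
  | trans _ _ _ _ _ ih₁ ih₂ => exact ih₁.trans ih₂

end Homotopic

theorem comp_assoc {a e f o : K} (r : PosetPath f o) (q : PosetPath e f) (p : PosetPath a e) :
    comp (comp r q) p = comp r (comp q p) := by
  induction r with
  | single b => rfl
  | cons b r ih => simp [comp, ih]

theorem comp_congr_right {a e o : K} (q : PosetPath e o) {p p' : PosetPath a e}
    (h : Homotopic p p') : Homotopic (comp q p) (comp q p') := by
  induction q with
  | single b => exact h.cons b
  | cons b q ih => exact ih.cons b

theorem Deform.comp_right {a e o : K} {q q' : PosetPath e o} (h : Deform q q')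
    (p : PosetPath a e) : Deform (comp q p) (comp q' p) := by
  induction h with
  | last c => exact Deform.mid c p
  | mid c r => exact Deform.mid c (comp r p)
  | cons b _ ih => exact Deform.cons b ih

theorem comp_congr_left {a e o : K} {q q' : PosetPath e o} (h : Homotopic q q')
    (p : PosetPath a e) : Homotopic (comp q p) (comp q' p) := by
  induction h with
  | rel _ _ h => exact Relation.EqvGen.rel _ _ (h.comp_right p)
  | refl _ => exact Homotopic.refl _
  | symm _ _ _ ih => exact ih.symm
  | trans _ _ _ _ _ ih₁ ih₂ => exact ih₁.trans ih₂

theorem comp_congr {a e o : K} {q q' : PosetPath e o} {p p' : PosetPath a e}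
    (h : Homotopic q q') (h' : Homotopic p p') : Homotopic (comp q p) (comp q' p') :=
  (comp_congr_left h p).trans (comp_congr_right q' h')

theorem triv_comp {a o : K} (p : PosetPath a o) : Homotopic (comp (triv o) p) p := by
  cases p with
  | single b =>
    exact Relation.EqvGen.rel _ _ (Deform.last
      ⟨OneSimplex.degen o, b, b, b.supp, b.tgt_le, le_rfl, le_rfl⟩)
  | cons b p =>
    exact Relation.EqvGen.rel _ _ (Deform.mid
      ⟨OneSimplex.degen o, b, b, b.supp, b.tgt_le, le_rfl, le_rfl⟩ p)

theorem comp_triv {a o : K} (p : PosetPath a o) : Homotopic (comp p (triv a)) p := by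
  induction p with
  | @single o b =>
    exact Relation.EqvGen.rel _ _ (Deform.last
      ⟨b, b, OneSimplex.degen a, b.supp, le_rfl, le_rfl, b.src_le⟩)
  | cons b p ih => exact ih.cons b

theorem opp_cons {a e o : K} (b : OneSimplex e o) (p : PosetPath a e) :
    Homotopic (comp (single b.opp) (PosetPath.cons b p)) p :=
  Homotopic.trans (Relation.EqvGen.rel _ _ (Deform.mid
    ⟨b.opp, OneSimplex.degen e, b, b.supp, le_rfl, b.src_le, le_rfl⟩ p)) (triv_comp p)

theorem rev_comp {a o : K} (p : PosetPath a o) : Homotopic (comp (rev p) p) (triv a) := by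
  induction p with
  | @single o b =>
    exact Relation.EqvGen.rel _ _ (Deform.last
      ⟨b.opp, OneSimplex.degen a, b, b.supp, le_rfl, b.src_le, le_rfl⟩)
  | cons b p ih =>
    have h : comp (rev (PosetPath.cons b p)) (PosetPath.cons b p)
        = comp (rev p) (comp (single b.opp) (PosetPath.cons b p)) := by
      rw [rev, comp_assoc]
    rw [h]
    exact (comp_congr_right _ (opp_cons b p)).trans ih

theorem comp_rev {a o : K} (p : PosetPath a o) : Homotopic (comp p (rev p)) (triv o) := by
  induction p with
  | @single o b =>
    exact Relation.EqvGen.rel _ _ (Deform.last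
      ⟨b, OneSimplex.degen o, b.opp, b.supp, le_rfl, b.tgt_le, le_rfl⟩)
  | @cons e o b p ih =>
    have h : comp (PosetPath.cons b p) (rev (PosetPath.cons b p))
        = comp (single b) (comp (comp p (rev p)) (single b.opp)) := by
      rw [rev, comp_assoc]; rfl
    rw [h]
    refine (comp_congr_right _ ((comp_congr_left ih _).trans (triv_comp _))).trans ?_
    exact Relation.EqvGen.rel _ _ (Deform.last
      ⟨b, OneSimplex.degen o, b.opp, b.supp, le_rfl, b.tgt_le, le_rfl⟩)

theorem rev_congr_aux {a o : K} {p q : PosetPath a o} (h : Homotopic p q) :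
    Homotopic (rev p) (rev q) := by
  have h₁ : Homotopic (comp (rev p) (comp q (rev q))) (rev p) :=
    (comp_congr_right _ (comp_rev q)).trans (comp_triv _)
  have h₂ : Homotopic (comp (comp (rev p) q) (rev q)) (rev q) :=
    (comp_congr_left ((comp_congr_right _ h.symm).trans (rev_comp p)) _).trans (triv_comp _)
  rw [comp_assoc] at h₂
  exact h₁.symm.trans h₂

theorem nerve_comp_nerve {e a o : K} (h₁ : e ≤ a) (h₂ : a ≤ o) :
    Homotopic (comp (nerve h₂) (nerve h₁)) (nerve (h₁.trans h₂)) :=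
  Relation.EqvGen.rel _ _ (Deform.last
    ⟨OneSimplex.nerve h₂, OneSimplex.nerve (h₁.trans h₂), OneSimplex.nerve h₁, o,
      le_rfl, le_rfl, h₂⟩)

instance homotopySetoid (a o : K) : Setoid (PosetPath a o) where
  r := Homotopic
  iseqv := ⟨Homotopic.refl, Homotopic.symm, Homotopic.trans⟩

end PosetPath

open PosetPath

variable (K) in
/-- Pathwise connectedness of a poset. -/
def IsPathConnected : Prop := ∀ a o : K, Nonempty (PosetPath a o)

/-- The first homotopy group of the poset with base point `o`: loops over `o` up to homotopy. -/
def HomotopyGroup (o : K) : Type v := Quotient (homotopySetoid o o)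

/-- The product is `[p] * [q] = [p * q]`. -/
instance (o : K) : Group (HomotopyGroup o) where
  mul := Quotient.map₂ comp fun _ _ h _ _ h' => comp_congr h h'
  one := Quotient.mk _ (triv o)
  inv := Quotient.map rev fun _ _ h => rev_congr_aux h
  mul_assoc := by
    rintro ⟨p⟩ ⟨q⟩ ⟨r⟩
    exact congrArg (Quotient.mk _) (comp_assoc p q r)
  one_mul := by rintro ⟨p⟩; exact Quotient.sound (triv_comp p)
  mul_one := by rintro ⟨p⟩; exact Quotient.sound (comp_triv p)
  inv_mul_cancel := by rintro ⟨p⟩; exact Quotient.sound (rev_comp p)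

end Paths

section Symmetry

variable {K : Type v} [PartialOrder K] {G : Type w} [Group G] [MulAction G K]
  [CovariantClass G K HSMul.hSMul LE.le]

/-- The action of an order preserving symmetry on 1-simplices. -/
def OneSimplex.smul (g : G) {a o : K} (b : OneSimplex a o) : OneSimplex (g • a) (g • o) :=
  ⟨g • b.supp, smul_mono_right g b.src_le, smul_mono_right g b.tgt_le⟩

/-- The action of an order preserving symmetry on paths. -/
def PosetPath.smul (g : G) {a : K} : {o : K} → PosetPath a o → PosetPath (g • a) (g • o)
  | _, .single b => .single (b.smul g)
  | _, .cons b p => .cons (b.smul g) (PosetPath.smul g p)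

variable (G K) in
/-- The topological group `G` is a continuous symmetry group of `K`: for every path `p : x → y` and
all `a₀ > y`, `a₁ > x`, one has `g y ≤ a₀`, `g x ≤ a₁` and
`(a₀, g y) * g p * (a₁, g x)⁻ ∼ (a₀, y) * p * (a₁, x)⁻` for all `g` in some neighbourhood of `1`. -/
def IsContinuousSymmetry [TopologicalSpace G] : Prop :=
  ∀ (x y : K) (p : PosetPath x y) (a₀ a₁ : K) (h₀ : y < a₀) (h₁ : x < a₁),
    ∀ᶠ g in 𝓝 (1 : G), ∃ (k₀ : g • y ≤ a₀) (k₁ : g • x ≤ a₁),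
      PosetPath.Homotopic
        (((PosetPath.nerve k₀).comp (p.smul g)).comp (PosetPath.nerve k₁).rev)
        (((PosetPath.nerve h₀.le).comp p).comp (PosetPath.nerve h₁.le).rev)

end Symmetry

section Amenability

/-- `m` restricts to a right invariant mean on the set `S` of real functions on `G`. -/
structure IsRightInvariantMean {G : Type w} [Group G] (S : Set (G → ℝ)) (m : (G → ℝ) → ℝ) :
    Prop where
  map_add : ∀ f ∈ S, ∀ f' ∈ S, m (f + f') = m f + m f'
  map_smul : ∀ (c : ℝ), ∀ f ∈ S, m (c • f) = c * m f
  nonneg : ∀ f ∈ S, 0 ≤ f → 0 ≤ m f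
  map_one : m 1 = 1
  map_right : ∀ (h : G), ∀ f ∈ S, m (fun x => f (x * h)) = m f

/-- Amenability of a (discrete) group: there is an invariant mean on the bounded functions. -/
def IsAmenable (G : Type w) [Group G] : Prop :=
  ∃ m, IsRightInvariantMean {f : G → ℝ | ∃ C, ∀ x, |f x| ≤ C} m

/-- Amenability of a topological group: there is an invariant mean on the bounded uniformly
continuous functions, i.e. the bounded functions `f` whose right translates `x ↦ f (x * v)` depend
continuously on `v` for the supremum norm. For discrete groups this is `IsAmenable`, and for
locally compact groups it is equivalent to the existence of an invariant mean on `L^∞`. -/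
def IsTopologicallyAmenable (G : Type w) [Group G] [TopologicalSpace G] : Prop :=
  ∃ m, IsRightInvariantMean {f : G → ℝ | (∃ C, ∀ x, |f x| ≤ C) ∧
    ∀ ε > 0, ∀ᶠ v in 𝓝 (1 : G), ∀ x, |f (x * v) - f x| ≤ ε} m

end Amenability

section Nets

/-- A net of C⋆-algebras over the poset `K`: unital C⋆-algebras `𝒜 o` and unital faithful
⋆-morphisms `𝒜 a → 𝒜 o` for `a ≤ o`, satisfying the net relations. -/
structure CStarNet (K : Type v) [PartialOrder K] where
  Fib : K → Type u
  [cstar : ∀ o, CStarAlgebra (Fib o)]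
  incl : ∀ {a o : K}, a ≤ o → Fib a →⋆ₐ[ℂ] Fib o
  incl_injective : ∀ {a o : K} (h : a ≤ o), Function.Injective (incl h)
  incl_comp : ∀ {e a o : K} (h₁ : e ≤ a) (h₂ : a ≤ o) (x : Fib e),
    incl h₂ (incl h₁ x) = incl (h₁.trans h₂) x

attribute [instance] CStarNet.cstar

variable {K : Type v} [PartialOrder K]

/-- A C⋆-net bundle: all inclusion maps are ⋆-isomorphisms. -/
def CStarNet.IsBundle (𝒜 : CStarNet.{u, v} K) : Prop :=
  ∀ {a o : K} (h : a ≤ o), Function.Bijective (𝒜.incl h)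

/-- A morphism of nets of C⋆-algebras over the same poset (not necessarily unital). -/
structure CStarNet.Hom (𝒜 : CStarNet.{u, v} K) (ℬ : CStarNet.{w, v} K) where
  app : ∀ o, 𝒜.Fib o →⋆ₙₐ[ℂ] ℬ.Fib o
  naturality : ∀ {a o : K} (h : a ≤ o) (x : 𝒜.Fib a),
    app o (𝒜.incl h x) = ℬ.incl h (app a x)

/-- A morphism (over the identity of `K`) is a monomorphism if all its components are faithful. -/
def CStarNet.Hom.IsMono {𝒜 : CStarNet.{u, v} K} {ℬ : CStarNet.{w, v} K} (φ : 𝒜.Hom ℬ) : Prop :=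
  ∀ o, Function.Injective (φ.app o)

end Nets

section Enveloping

variable {K : Type v} [PartialOrder K] (𝒜 : CStarNet.{u, v} K)

/-- The symbols `(p, A)`, where `p` is a path ending at `o` and `A` lies in the fibre over the
starting point of `p`. -/
structure EnvGen (o : K) : Type (max u v) where
  src : K
  path : PosetPath src o
  elem : 𝒜.Fib src

/-- The symbol `(p, A)` as an element of the free unital algebra. -/
def freeSymb {a o : K} (p : PosetPath a o) (x : 𝒜.Fib a) : FreeAlgebra ℂ (EnvGen 𝒜 o) :=
  FreeAlgebra.ι ℂ ⟨a, p, x⟩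

/-- The relations imposed on the free unital algebra: for fixed `p` the symbol `(p, A)` is a unital
algebra homomorphism in `A`, isotony `(p, j A) = (p * (ãa), A)`, and homotopy invariance. -/
inductive EnvRel (o : K) : FreeAlgebra ℂ (EnvGen 𝒜 o) → FreeAlgebra ℂ (EnvGen 𝒜 o) → Prop
  | mul {a : K} (p : PosetPath a o) (x y : 𝒜.Fib a) :
      EnvRel o (freeSymb 𝒜 p x * freeSymb 𝒜 p y) (freeSymb 𝒜 p (x * y))
  | add {a : K} (p : PosetPath a o) (x y : 𝒜.Fib a) :
      EnvRel o (freeSymb 𝒜 p (x + y)) (freeSymb 𝒜 p x + freeSymb 𝒜 p y)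
  | smul {a : K} (p : PosetPath a o) (c : ℂ) (x : 𝒜.Fib a) :
      EnvRel o (freeSymb 𝒜 p (c • x)) (c • freeSymb 𝒜 p x)
  | one {a : K} (p : PosetPath a o) : EnvRel o (freeSymb 𝒜 p 1) 1
  | zero {a : K} (p : PosetPath a o) : EnvRel o (freeSymb 𝒜 p 0) 0
  | isotony {e a : K} (h : e ≤ a) (p : PosetPath a o) (x : 𝒜.Fib e) :
      EnvRel o (freeSymb 𝒜 p (𝒜.incl h x)) (freeSymb 𝒜 (p.comp (PosetPath.nerve h)) x)
  | homotopy {a : K} {p q : PosetPath a o} (h : p.Homotopic q) (x : 𝒜.Fib a) :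
      EnvRel o (freeSymb 𝒜 p x) (freeSymb 𝒜 q x)

/-- The ⋆-algebra over `o` generated by the symbols `(p, A)` subject to the above relations. -/
def EnvAlg (o : K) : Type (max u v) := RingQuot (EnvRel 𝒜 o)

namespace EnvAlg

variable {𝒜} {o : K}

instance : Ring (EnvAlg 𝒜 o) := inferInstanceAs (Ring (RingQuot (EnvRel 𝒜 o)))
instance : Algebra ℂ (EnvAlg 𝒜 o) := inferInstanceAs (Algebra ℂ (RingQuot (EnvRel 𝒜 o)))

/-- The quotient map from the free algebra. -/
def mk (o : K) : FreeAlgebra ℂ (EnvGen 𝒜 o) →ₐ[ℂ] EnvAlg 𝒜 o :=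
  RingQuot.mkAlgHom ℂ (EnvRel 𝒜 o)

/-- The class of the symbol `(p, A)`. -/
def symb {a : K} (p : PosetPath a o) (x : 𝒜.Fib a) : EnvAlg 𝒜 o := mk o (freeSymb 𝒜 p x)

theorem mk_rel {x y : FreeAlgebra ℂ (EnvGen 𝒜 o)} (h : EnvRel 𝒜 o x y) : mk o x = mk o y :=
  RingQuot.mkAlgHom_rel ℂ h

theorem symb_mul {a : K} (p : PosetPath a o) (x y : 𝒜.Fib a) :
    symb p (x * y) = symb p x * symb p y :=
  ((map_mul (mk o) _ _).symm.trans (mk_rel (EnvRel.mul p x y))).symm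

theorem symb_add {a : K} (p : PosetPath a o) (x y : 𝒜.Fib a) :
    symb p (x + y) = symb p x + symb p y :=
  (mk_rel (EnvRel.add p x y)).trans (map_add (mk o) _ _)

theorem symb_smul {a : K} (p : PosetPath a o) (c : ℂ) (x : 𝒜.Fib a) :
    symb p (c • x) = c • symb p x :=
  (mk_rel (EnvRel.smul p c x)).trans (map_smul (mk o) _ _)

theorem symb_one {a : K} (p : PosetPath a o) : symb p (1 : 𝒜.Fib a) = 1 :=
  (mk_rel (EnvRel.one p)).trans (map_one (mk o))

theorem symb_zero {a : K} (p : PosetPath a o) : symb p (0 : 𝒜.Fib a) = 0 :=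
  (mk_rel (EnvRel.zero p)).trans (map_zero (mk o))

theorem symb_isotony {e a : K} (h : e ≤ a) (p : PosetPath a o) (x : 𝒜.Fib e) :
    symb p (𝒜.incl h x) = symb (p.comp (PosetPath.nerve h)) x :=
  mk_rel (EnvRel.isotony h p x)

theorem symb_homotopy {a : K} {p q : PosetPath a o} (h : p.Homotopic q) (x : 𝒜.Fib a) :
    symb p x = symb q x :=
  mk_rel (EnvRel.homotopy h x)

theorem induction {P : EnvAlg 𝒜 o → Prop} (scalar : ∀ c : ℂ, P (algebraMap ℂ _ c))
    (symb : ∀ {a : K} (p : PosetPath a o) (x : 𝒜.Fib a), P (symb p x))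
    (mul : ∀ x y, P x → P y → P (x * y)) (add : ∀ x y, P x → P y → P (x + y))
    (x : EnvAlg 𝒜 o) : P x := by
  obtain ⟨x, rfl⟩ := RingQuot.mkAlgHom_surjective ℂ (EnvRel 𝒜 o) x
  change P (mk o x)
  induction x with
  | grade0 c => rw [AlgHom.commutes]; exact scalar c
  | grade1 s => exact symb s.path s.elem
  | mul x y hx hy => rw [map_mul]; exact mul _ _ hx hy
  | add x y hx hy => rw [map_add]; exact add _ _ hx hy

/-- The universal property: families of maps respecting the relations extend to algebra
homomorphisms. -/
def lift {R : Type*} [Ring R] [Algebra ℂ R]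
    (f : ∀ {a : K}, PosetPath a o → 𝒜.Fib a → R)
    (f_mul : ∀ {a : K} (p : PosetPath a o) (x y : 𝒜.Fib a), f p (x * y) = f p x * f p y)
    (f_add : ∀ {a : K} (p : PosetPath a o) (x y : 𝒜.Fib a), f p (x + y) = f p x + f p y)
    (f_smul : ∀ {a : K} (p : PosetPath a o) (c : ℂ) (x : 𝒜.Fib a), f p (c • x) = c • f p x)
    (f_one : ∀ {a : K} (p : PosetPath a o), f p (1 : 𝒜.Fib a) = 1)
    (f_isotony : ∀ {e a : K} (h : e ≤ a) (p : PosetPath a o) (x : 𝒜.Fib e),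
      f p (𝒜.incl h x) = f (p.comp (PosetPath.nerve h)) x)
    (f_homotopy : ∀ {a : K} {p q : PosetPath a o} (_ : p.Homotopic q) (x : 𝒜.Fib a),
      f p x = f q x) : EnvAlg 𝒜 o →ₐ[ℂ] R :=
  RingQuot.liftAlgHom ℂ ⟨FreeAlgebra.lift ℂ fun s : EnvGen 𝒜 o => f s.path s.elem, by
    intro x y h
    induction h with
    | mul p x y => simp [freeSymb, f_mul]
    | add p x y => simp [freeSymb, f_add]
    | smul p c x => simp [freeSymb, f_smul]
    | one p => simp [freeSymb, f_one]
    | zero p => simpa [freeSymb] using f_smul p 0 0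
    | isotony h p x => simp [freeSymb, f_isotony]
    | homotopy h x => simpa [freeSymb] using f_homotopy h x⟩

theorem lift_symb {R : Type*} [Ring R] [Algebra ℂ R]
    (f : ∀ {a : K}, PosetPath a o → 𝒜.Fib a → R) (h₁ h₂ h₃ h₄ h₅ h₆) {a : K}
    (p : PosetPath a o) (x : 𝒜.Fib a) :
    lift f h₁ h₂ h₃ h₄ h₅ h₆ (symb p x) = f p x := by
  simp only [lift, symb, mk, freeSymb]
  exact (RingQuot.liftAlgHom_mkAlgHom_apply ..).trans (FreeAlgebra.lift_ι_apply ..)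

/-- The opposite ring with the complex conjugate scalar multiplication; algebra homomorphisms into
it are the antimultiplicative antilinear maps. -/
def ConjOp (R : Type*) : Type _ := Rᵐᵒᵖ

namespace ConjOp

/-- The identity map onto the conjugate opposite ring. -/
def op {R : Type*} (x : R) : ConjOp R := MulOpposite.op x

/-- The identity map from the conjugate opposite ring. -/
def unop {R : Type*} (x : ConjOp R) : R := MulOpposite.unop x

variable {R : Type*} [Ring R]

instance : Ring (ConjOp R) := inferInstanceAs (Ring Rᵐᵒᵖ)

theorem op_add (x y : R) : op (x + y) = op x + op y := rfl
theorem op_mul (x y : R) : op (x * y) = op y * op x := rfl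
theorem op_one : op (1 : R) = 1 := rfl
theorem unop_add (x y : ConjOp R) : unop (x + y) = unop x + unop y := rfl
theorem unop_mul (x y : ConjOp R) : unop (x * y) = unop y * unop x := rfl

instance [Algebra ℂ R] : Algebra ℂ (ConjOp R) :=
  RingHom.toAlgebra' ((algebraMap ℂ Rᵐᵒᵖ).comp (starRingEnd ℂ)) fun c x =>
    Algebra.commutes (A := Rᵐᵒᵖ) (starRingEnd ℂ c) x

theorem algebraMap_def [Algebra ℂ R] (c : ℂ) :
    algebraMap ℂ (ConjOp R) c = op (algebraMap ℂ R (starRingEnd ℂ c)) := rfl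

theorem op_smul [Algebra ℂ R] (c : ℂ) (x : R) : op (starRingEnd ℂ c • x) = c • op x := by
  rw [Algebra.smul_def, Algebra.smul_def, algebraMap_def, Algebra.commutes, op_mul]

end ConjOp

/-- The adjoint, as a homomorphism into the conjugate opposite algebra: `(p, A)⋆ = (p, A⋆)`. -/
def starHom (o : K) : EnvAlg 𝒜 o →ₐ[ℂ] ConjOp (EnvAlg 𝒜 o) :=
  lift (fun p x => ConjOp.op (symb p (star x)))
    (fun p x y => by rw [star_mul, symb_mul, ConjOp.op_mul])
    (fun p x y => by rw [star_add, symb_add, ConjOp.op_add])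
    (fun p c x => by rw [star_smul, symb_smul]; exact ConjOp.op_smul _ _)
    (fun p => by rw [star_one, symb_one, ConjOp.op_one])
    (fun h p x => by rw [← map_star, symb_isotony])
    (fun h x => by rw [symb_homotopy h])

instance : Star (EnvAlg 𝒜 o) := ⟨fun x => ConjOp.unop (starHom o x)⟩

theorem star_symb {a : K} (p : PosetPath a o) (x : 𝒜.Fib a) :
    star (symb p x) = symb p (star x) :=
  congrArg ConjOp.unop (lift_symb ..)

theorem star_add' (x y : EnvAlg 𝒜 o) : star (x + y) = star x + star y :=
  congrArg ConjOp.unop (map_add (starHom o) x y)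

theorem star_mul' (x y : EnvAlg 𝒜 o) : star (x * y) = star y * star x :=
  congrArg ConjOp.unop (map_mul (starHom o) x y)

theorem star_algebraMap' (c : ℂ) :
    star (algebraMap ℂ (EnvAlg 𝒜 o) c) = algebraMap ℂ _ (starRingEnd ℂ c) :=
  congrArg ConjOp.unop ((starHom o).commutes c)

instance : StarRing (EnvAlg 𝒜 o) where
  star_involutive x := by
    induction x using induction with
    | scalar c => rw [star_algebraMap', star_algebraMap', Complex.conj_conj]
    | symb p x => rw [star_symb, star_symb, star_star]
    | mul x y hx hy => rw [star_mul', star_mul', hx, hy]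
    | add x y hx hy => rw [star_add', star_add', hx, hy]
  star_mul := star_mul'
  star_add := star_add'

instance : StarModule ℂ (EnvAlg 𝒜 o) where
  star_smul c x := by
    rw [Algebra.smul_def, star_mul', star_algebraMap', Algebra.smul_def, ← Algebra.commutes]
    rfl

/-- The ⋆-morphism `(p, A) ↦ (q * p, A)` attached to a path `q : o → o'`. -/
def transport {o' : K} (q : PosetPath o o') : EnvAlg 𝒜 o →⋆ₐ[ℂ] EnvAlg 𝒜 o' where
  toAlgHom := lift (fun p x => symb (q.comp p) x)
    (fun p x y => symb_mul _ _ _) (fun p x y => symb_add _ _ _) (fun p c x => symb_smul _ _ _)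
    (fun p => symb_one _)
    (fun h p x => by rw [symb_isotony, PosetPath.comp_assoc])
    (fun h x => symb_homotopy (PosetPath.comp_congr_right q h) x)
  map_star' x := by
    simp only [AlgHom.toRingHom_eq_coe, RingHom.toMonoidHom_eq_coe, OneHom.toFun_eq_coe,
      MonoidHom.toOneHom_coe, MonoidHom.coe_coe, RingHom.coe_coe]
    induction x using induction with
    | scalar c => rw [star_algebraMap', AlgHom.commutes, AlgHom.commutes, star_algebraMap']
    | symb p x => rw [star_symb, lift_symb, lift_symb, star_symb]
    | mul x y hx hy => rw [star_mul', map_mul, map_mul, hx, hy, star_mul']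
    | add x y hx hy => rw [star_add', map_add, map_add, hx, hy, star_add']

theorem transport_symb {a o' : K} (q : PosetPath o o') (p : PosetPath a o) (x : 𝒜.Fib a) :
    transport q (symb p x) = symb (q.comp p) x :=
  lift_symb ..

theorem transport_comp {o₁ o₂ o₃ : K} (r : PosetPath o₂ o₃) (q : PosetPath o₁ o₂)
    (x : EnvAlg 𝒜 o₁) : transport r (transport q x) = transport (r.comp q) x := by
  induction x using induction with
  | scalar c => simp only [AlgHomClass.commutes]
  | symb p x => rw [transport_symb, transport_symb, transport_symb, PosetPath.comp_assoc]
  | mul x y hx hy => simp only [map_mul, hx, hy]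
  | add x y hx hy => simp only [map_add, hx, hy]

theorem transport_homotopy {o' : K} {q q' : PosetPath o o'} (h : q.Homotopic q')
    (x : EnvAlg 𝒜 o) : transport q x = transport q' x := by
  induction x using induction with
  | scalar c => simp only [AlgHomClass.commutes]
  | symb p x =>
    rw [transport_symb, transport_symb, symb_homotopy (PosetPath.comp_congr_left h p)]
  | mul x y hx hy => simp only [map_mul, hx, hy]
  | add x y hx hy => simp only [map_add, hx, hy]

theorem transport_triv (x : EnvAlg 𝒜 o) : transport (PosetPath.triv o) x = x := by
  induction x using induction with
  | scalar c => simp only [AlgHomClass.commutes]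
  | symb p x => rw [transport_symb, symb_homotopy (PosetPath.triv_comp p)]
  | mul x y hx hy => simp only [map_mul, hx, hy]
  | add x y hx hy => simp only [map_add, hx, hy]

theorem transport_rev {o' : K} (q : PosetPath o o') (x : EnvAlg 𝒜 o) :
    transport q.rev (transport q x) = x := by
  rw [transport_comp, transport_homotopy (PosetPath.rev_comp q), transport_triv]

theorem transport_rev' {o' : K} (q : PosetPath o o') (x : EnvAlg 𝒜 o') :
    transport q (transport q.rev x) = x := by
  rw [transport_comp, transport_homotopy (PosetPath.comp_rev q), transport_triv]

/-- The inclusion maps of the enveloping bundle of ⋆-algebras: `(p, A) ↦ ((õo) * p, A)`. -/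
def incl {o' : K} (h : o ≤ o') : EnvAlg 𝒜 o →⋆ₐ[ℂ] EnvAlg 𝒜 o' := transport (PosetPath.nerve h)

end EnvAlg

/-- A ⋆-morphism from the enveloping bundle of ⋆-algebras into a net of C⋆-algebras. -/
structure EnvAlg.Hom (ℬ : CStarNet.{w, v} K) where
  app : ∀ o, EnvAlg 𝒜 o →⋆ₙₐ[ℂ] ℬ.Fib o
  naturality : ∀ {a o : K} (h : a ≤ o) (x : EnvAlg 𝒜 a),
    app o (EnvAlg.incl h x) = ℬ.incl h (app a x)

namespace EnvAlg

variable {𝒜} {o : K}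

/-- The unital ⋆-morphism `A ↦ (p, A)`. -/
def symbHom {a : K} (p : PosetPath a o) : 𝒜.Fib a →⋆ₐ[ℂ] EnvAlg 𝒜 o where
  toFun := symb p
  map_one' := symb_one p
  map_mul' := symb_mul p
  map_zero' := symb_zero p
  map_add' := symb_add p
  commutes' c := by
    rw [Algebra.algebraMap_eq_smul_one, symb_smul, symb_one, ← Algebra.algebraMap_eq_smul_one]
  map_star' x := (star_symb p x).symm

/-- The set of the values `‖π_o(W)‖`, for all morphisms `π` into C⋆-net bundles. -/
def normSet (W : EnvAlg 𝒜 o) : Set ℝ :=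
  {r | ∃ (ℬ : CStarNet.{max u v, v} K) (_ : ℬ.IsBundle) (π : EnvAlg.Hom 𝒜 ℬ), r = ‖π.app o W‖}

/-- The C⋆-seminorm `‖W‖ = sup_π ‖π_o(W)‖`. -/
noncomputable def envNorm (W : EnvAlg 𝒜 o) : ℝ := sSup (normSet W)

theorem bddAbove_normSet (W : EnvAlg 𝒜 o) : BddAbove (normSet W) := by
  have key : ∀ {a : K} (p : PosetPath a o) (x : 𝒜.Fib a), ‖x‖ ∈ upperBounds (normSet (symb p x)) := by
    rintro a p x _ ⟨ℬ, -, π, rfl⟩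
    exact NonUnitalStarAlgHom.norm_apply_le
      ((π.app o).comp (symbHom p).toNonUnitalStarAlgHom) x
  induction W using induction with
  | scalar c =>
    refine ⟨‖c • (1 : 𝒜.Fib o)‖, ?_⟩
    rw [Algebra.algebraMap_eq_smul_one, ← symb_one (PosetPath.triv o), ← symb_smul]
    exact key _ _
  | symb p x => exact ⟨_, key p x⟩
  | mul x y hx hy =>
    obtain ⟨C, hC⟩ := hx
    obtain ⟨D, hD⟩ := hy
    refine ⟨C * D, ?_⟩
    rintro _ ⟨ℬ, hℬ, π, rfl⟩
    rw [map_mul]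
    have h₁ := hC ⟨ℬ, hℬ, π, rfl⟩
    have h₂ := hD ⟨ℬ, hℬ, π, rfl⟩
    exact (norm_mul_le _ _).trans
      (mul_le_mul h₁ h₂ (norm_nonneg _) ((norm_nonneg _).trans h₁))
  | add x y hx hy =>
    obtain ⟨C, hC⟩ := hx
    obtain ⟨D, hD⟩ := hy
    refine ⟨C + D, ?_⟩
    rintro _ ⟨ℬ, hℬ, π, rfl⟩
    rw [map_add]
    exact (norm_add_le _ _).trans (add_le_add (hC ⟨ℬ, hℬ, π, rfl⟩) (hD ⟨ℬ, hℬ, π, rfl⟩))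

theorem norm_app_le (ℬ : CStarNet.{max u v, v} K) (hℬ : ℬ.IsBundle) (π : EnvAlg.Hom 𝒜 ℬ)
    (W : EnvAlg 𝒜 o) : ‖π.app o W‖ ≤ envNorm W :=
  le_csSup (bddAbove_normSet W) ⟨ℬ, hℬ, π, rfl⟩

theorem envNorm_nonneg (W : EnvAlg 𝒜 o) : 0 ≤ envNorm W :=
  Real.sSup_nonneg (by rintro _ ⟨ℬ, -, π, rfl⟩; exact norm_nonneg _)

theorem envNorm_le {W : EnvAlg 𝒜 o} {C : ℝ} (hC : 0 ≤ C)
    (h : ∀ (ℬ : CStarNet.{max u v, v} K) (_ : ℬ.IsBundle) (π : EnvAlg.Hom 𝒜 ℬ),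
      ‖π.app o W‖ ≤ C) : envNorm W ≤ C :=
  Real.sSup_le (by rintro _ ⟨ℬ, hℬ, π, rfl⟩; exact h ℬ hℬ π) hC

theorem envNorm_mul_le (x y : EnvAlg 𝒜 o) : envNorm (x * y) ≤ envNorm x * envNorm y :=
  envNorm_le (mul_nonneg (envNorm_nonneg _) (envNorm_nonneg _)) fun ℬ hℬ π => by
    rw [map_mul]
    exact (norm_mul_le _ _).trans (mul_le_mul (norm_app_le ℬ hℬ π x) (norm_app_le ℬ hℬ π y)
      (norm_nonneg _) (envNorm_nonneg _))

/-- `envNorm` as a ring seminorm. -/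
noncomputable def ringSeminorm (𝒜 : CStarNet.{u, v} K) (o : K) : RingSeminorm (EnvAlg 𝒜 o) where
  toFun := envNorm
  map_zero' := le_antisymm (envNorm_le le_rfl fun ℬ hℬ π => by simp) (envNorm_nonneg _)
  add_le' x y := envNorm_le (add_nonneg (envNorm_nonneg _) (envNorm_nonneg _)) fun ℬ hℬ π => by
    rw [map_add]
    exact (norm_add_le _ _).trans (add_le_add (norm_app_le ℬ hℬ π x) (norm_app_le ℬ hℬ π y))
  neg' x := by
    have h : normSet (-x) = normSet x := by
      ext r
      simp only [normSet, Set.mem_ofPred_eq, map_neg, norm_neg]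
    rw [envNorm, h, envNorm]
  mul_le' := envNorm_mul_le

noncomputable instance : SeminormedRing (EnvAlg 𝒜 o) := (ringSeminorm 𝒜 o).toSeminormedRing

theorem norm_def (x : EnvAlg 𝒜 o) : ‖x‖ = envNorm x := rfl

noncomputable instance : NormedAlgebra ℂ (EnvAlg 𝒜 o) where
  norm_smul_le c x := envNorm_le (mul_nonneg (norm_nonneg _) (envNorm_nonneg _)) fun ℬ hℬ π => by
    rw [map_smul, norm_smul]
    exact mul_le_mul_of_nonneg_left (norm_app_le ℬ hℬ π x) (norm_nonneg _)

instance : NormedStarGroup (EnvAlg 𝒜 o) where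
  norm_star_le x := envNorm_le (envNorm_nonneg _) fun ℬ hℬ π => by
    rw [map_star, norm_star]
    exact norm_app_le ℬ hℬ π x

theorem norm_mul_self_le (x : EnvAlg 𝒜 o) : ‖x‖ * ‖x‖ ≤ ‖star x * x‖ := by
  have h : ‖x‖ ≤ √‖star x * x‖ := envNorm_le (Real.sqrt_nonneg _) fun ℬ hℬ π => by
    refine Real.le_sqrt_of_sq_le ?_
    rw [pow_two, ← CStarRing.norm_star_mul_self, ← map_star, ← map_mul]
    exact norm_app_le ℬ hℬ π _
  calc ‖x‖ * ‖x‖ ≤ √‖star x * x‖ * √‖star x * x‖ :=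
        mul_le_mul h h (norm_nonneg _) (Real.sqrt_nonneg _)
    _ = ‖star x * x‖ := Real.mul_self_sqrt (norm_nonneg _)

theorem norm_incl {o' : K} (h : o ≤ o') (x : EnvAlg 𝒜 o) : ‖incl h x‖ = ‖x‖ := by
  have key : ∀ (ℬ : CStarNet.{max u v, v} K) (π : EnvAlg.Hom 𝒜 ℬ),
      ‖π.app o' (incl h x)‖ = ‖π.app o x‖ := fun ℬ π => by
    rw [π.naturality]
    exact NonUnitalStarAlgHom.norm_map (ℬ.incl h) (ℬ.incl_injective h) _
  apply le_antisymm
  · exact envNorm_le (envNorm_nonneg _) fun ℬ hℬ π => by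
      rw [key]; exact norm_app_le ℬ hℬ π x
  · exact envNorm_le (envNorm_nonneg _) fun ℬ hℬ π => by
      rw [← key]; exact norm_app_le ℬ hℬ π _

theorem incl_incl {e a : K} (h₁ : e ≤ a) (h₂ : a ≤ o) (x : EnvAlg 𝒜 e) :
    incl h₂ (incl h₁ x) = incl (h₁.trans h₂) x := by
  rw [incl, incl, incl, transport_comp, transport_homotopy (PosetPath.nerve_comp_nerve h₁ h₂)]

end EnvAlg

section Completion

open UniformSpace

variable {A B : Type*} [SeminormedRing A] [StarRing A] [NormedAlgebra ℂ A] [StarModule ℂ A]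
  [NormedStarGroup A] [SeminormedRing B] [StarRing B] [NormedAlgebra ℂ B] [StarModule ℂ B]
  [NormedStarGroup B]

/-- The star operation extends to the completion by continuity. -/
noncomputable instance {A : Type*} [SeminormedRing A] [StarRing A] : Star (Completion A) :=
  ⟨Completion.map star⟩

theorem completion_continuous_star {A : Type*} [SeminormedRing A] [StarRing A] :
    Continuous (star : Completion A → Completion A) :=
  Completion.continuous_map

theorem completion_coe_star (x : A) : star (x : Completion A) = (star x : A) :=
  Completion.map_coe (starₗᵢ (E := A) ℂ).isometry.uniformContinuous x

noncomputable instance : StarRing (Completion A) where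
  star_involutive x := by
    induction x using Completion.induction_on with
    | hp =>
      exact isClosed_eq (completion_continuous_star.comp completion_continuous_star)
        continuous_id
    | ih x => rw [completion_coe_star, completion_coe_star, star_star]
  star_mul x y := by
    induction x, y using Completion.induction_on₂ with
    | hp =>
      exact isClosed_eq (completion_continuous_star.comp (by fun_prop))
        ((completion_continuous_star.comp continuous_snd).mul
          (completion_continuous_star.comp continuous_fst))
    | ih x y =>
      rw [← Completion.coe_mul, completion_coe_star, completion_coe_star, completion_coe_star,
        star_mul, Completion.coe_mul]
  star_add x y := by
    induction x, y using Completion.induction_on₂ with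
    | hp =>
      exact isClosed_eq (completion_continuous_star.comp (by fun_prop))
        ((completion_continuous_star.comp continuous_fst).add
          (completion_continuous_star.comp continuous_snd))
    | ih x y =>
      rw [← Completion.coe_add, completion_coe_star, completion_coe_star, completion_coe_star,
        star_add, Completion.coe_add]

theorem completion_star_smul (c : ℂ) (x : Completion A) : star (c • x) = star c • star x := by
  rw [Algebra.smul_def, Algebra.smul_def, star_mul, Completion.algebraMap_def,
    Completion.algebraMap_def, completion_coe_star, ← algebraMap_star_comm,
    ← Completion.algebraMap_def, Algebra.commutes]

theorem completion_norm_mul_self_le (hA : ∀ x : A, ‖x‖ * ‖x‖ ≤ ‖star x * x‖)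
    (x : Completion A) : ‖x‖ * ‖x‖ ≤ ‖star x * x‖ := by
  induction x using Completion.induction_on with
  | hp =>
    exact isClosed_le (by fun_prop) ((completion_continuous_star.mul continuous_id).norm)
  | ih x =>
    rw [completion_coe_star, ← Completion.coe_mul, Completion.norm_coe, Completion.norm_coe]
    exact hA x

/-- The completion of a ⋆-algebra with a C⋆-seminorm (which includes dividing out the null
elements) is a C⋆-algebra. -/
@[reducible] noncomputable def completionCStarAlgebra (hA : ∀ x : A, ‖x‖ * ‖x‖ ≤ ‖star x * x‖) :
    CStarAlgebra (Completion A) where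
  __ : NormedRing (Completion A) := inferInstance
  __ : StarRing (Completion A) := inferInstance
  __ : CompleteSpace (Completion A) := inferInstance
  __ : Algebra ℂ (Completion A) := inferInstance
  norm_smul_le := norm_smul_le
  star_smul := completion_star_smul
  norm_mul_self_le := completion_norm_mul_self_le hA

/-- The extension of an isometric ⋆-morphism to the completions. -/
noncomputable def completionMap (f : A →⋆ₐ[ℂ] B) (hf : ∀ x, ‖f x‖ = ‖x‖) :
    Completion A →⋆ₐ[ℂ] Completion B :=
  have hf' : Continuous f := (AddMonoidHomClass.isometry_of_norm f hf).continuous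
  { Completion.mapRingHom (f : A →+* B) hf' with
    commutes' := fun c => by
      change Completion.map f (algebraMap ℂ A c : A) = (algebraMap ℂ B c : B)
      rw [Completion.map_coe (AddMonoidHomClass.isometry_of_norm f hf).uniformContinuous,
        AlgHomClass.commutes]
    map_star' := fun x => by
      change Completion.map f (star x) = star (Completion.map f x)
      induction x using Completion.induction_on with
      | hp =>
        exact isClosed_eq (Completion.continuous_map.comp completion_continuous_star)
          (completion_continuous_star.comp Completion.continuous_map)
      | ih x =>
        have h := (AddMonoidHomClass.isometry_of_norm f hf).uniformContinuous
        rw [completion_coe_star, Completion.map_coe h, Completion.map_coe h, completion_coe_star,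
          map_star] }

theorem completionMap_coe (f : A →⋆ₐ[ℂ] B) (hf : ∀ x, ‖f x‖ = ‖x‖) (x : A) :
    completionMap f hf (x : Completion A) = (f x : B) :=
  Completion.map_coe (AddMonoidHomClass.isometry_of_norm f hf).uniformContinuous x

theorem completionMap_isometry (f : A →⋆ₐ[ℂ] B) (hf : ∀ x, ‖f x‖ = ‖x‖) :
    Isometry (completionMap f hf) :=
  (AddMonoidHomClass.isometry_of_norm f hf).completion_map

end Completion

noncomputable instance (o : K) : CStarAlgebra (UniformSpace.Completion (EnvAlg 𝒜 o)) :=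
  completionCStarAlgebra EnvAlg.norm_mul_self_le

/-- The enveloping net bundle of a net of C⋆-algebras: the fibre over `o` is the completion of the
⋆-algebra generated by the symbols `(p, A)` in the maximal C⋆-seminorm. -/
noncomputable def envelopingNet : CStarNet.{max u v, v} K where
  Fib o := UniformSpace.Completion (EnvAlg 𝒜 o)
  incl h := completionMap (EnvAlg.incl h) (EnvAlg.norm_incl h)
  incl_injective h := (completionMap_isometry _ _).injective
  incl_comp h₁ h₂ x := by
    induction x using UniformSpace.Completion.induction_on with
    | hp =>
      exact isClosed_eq
        ((completionMap_isometry _ _).continuous.comp (completionMap_isometry _ _).continuous)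
        (completionMap_isometry _ _).continuous
    | ih x => rw [completionMap_coe, completionMap_coe, completionMap_coe, EnvAlg.incl_incl]

theorem envelopingNet_isBundle : (envelopingNet 𝒜).IsBundle := by
  intro a o h
  refine ⟨(envelopingNet 𝒜).incl_injective h, fun y => ?_⟩
  have hcl : IsClosed (Set.range (completionMap (EnvAlg.incl (𝒜 := 𝒜) h) (EnvAlg.norm_incl h))) :=
    (completionMap_isometry _ _).isClosedEmbedding.isClosed_range
  induction y using UniformSpace.Completion.induction_on with
  | hp =>
    exact hcl
  | ih y =>
    refine ⟨((EnvAlg.transport (PosetPath.nerve h).rev y : EnvAlg 𝒜 a) :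
      UniformSpace.Completion (EnvAlg 𝒜 a)), ?_⟩
    refine (completionMap_coe _ (EnvAlg.norm_incl h) _).trans ?_
    rw [EnvAlg.incl, EnvAlg.transport_rev']

/-- The canonical embedding `ε_o(A) = (ι_o, A)` of a net into its enveloping net bundle. -/
noncomputable def canonicalEmbedding : 𝒜.Hom (envelopingNet 𝒜) where
  app o :=
    { toFun := fun x => ((EnvAlg.symb (PosetPath.triv o) x : EnvAlg 𝒜 o) :
        UniformSpace.Completion (EnvAlg 𝒜 o))
      map_smul' := fun c x => by
        rw [EnvAlg.symb_smul, UniformSpace.Completion.coe_smul]; rfl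
      map_zero' := by rw [EnvAlg.symb_zero]; rfl
      map_add' := fun x y => by rw [EnvAlg.symb_add, UniformSpace.Completion.coe_add]; rfl
      map_mul' := fun x y => by rw [EnvAlg.symb_mul, UniformSpace.Completion.coe_mul]; rfl
      map_star' := fun x => by
        rw [← EnvAlg.star_symb]; exact (completion_coe_star _).symm }
  naturality {a o} h x := by
    refine Eq.trans ?_ (completionMap_coe _ (EnvAlg.norm_incl h) _).symm
    change ((EnvAlg.symb _ _ : EnvAlg 𝒜 o) : UniformSpace.Completion (EnvAlg 𝒜 o)) = _
    rw [EnvAlg.incl, EnvAlg.transport_symb, EnvAlg.symb_isotony,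
      EnvAlg.symb_homotopy (PosetPath.triv_comp (PosetPath.nerve h)),
      EnvAlg.symb_homotopy (PosetPath.comp_triv (PosetPath.nerve h))]

/-- A net is nondegenerate if its enveloping net bundle does not vanish. -/
def CStarNet.IsNondegenerate : Prop := ∃ o, Nontrivial ((envelopingNet 𝒜).Fib o)

/-- A nondegenerate net is injective if the canonical embedding is a monomorphism. -/
def CStarNet.IsInjective : Prop := 𝒜.IsNondegenerate ∧ (canonicalEmbedding 𝒜).IsMono

end Enveloping

section Covariance

variable {K : Type v} [PartialOrder K] {G : Type*} [Group G] [MulAction G K]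
  [CovariantClass G K HSMul.hSMul LE.le]

variable (G) in
/-- The structure of a `G`-covariant net: ⋆-isomorphisms `α^g_o : 𝒜 o → 𝒜 (g o)` satisfying
`α^h_{go} ∘ α^g_o = α^{hg}_o` and compatible with the inclusion maps. In the first law the equal
fibres over `h (g o)` and `(h g) o` are identified by the inclusion map, which is the identity. -/
structure CStarNet.Action (𝒜 : CStarNet.{u, v} K) where
  act : ∀ (g : G) (o : K), 𝒜.Fib o ≃⋆ₐ[ℂ] 𝒜.Fib (g • o)
  act_mul : ∀ (h g : G) (o : K) (x : 𝒜.Fib o),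
    𝒜.incl (mul_smul h g o).ge (act h (g • o) (act g o x)) = act (h * g) o x
  act_incl : ∀ (g : G) {a o : K} (k : a ≤ o) (x : 𝒜.Fib a),
    act g o (𝒜.incl k x) = 𝒜.incl (smul_mono_right g k) (act g a x)

/-- Continuity of the action on the net: for `a > o`, if `g` tends to `1` then eventually `g o ≤ a`
and `j_{a,go} (α^g_o A)` tends to `j_{ao} A` in norm, for all `A`. -/
def CStarNet.Action.IsContinuous [TopologicalSpace G] {𝒜 : CStarNet.{u, v} K}
    (α : 𝒜.Action G) : Prop :=
  ∀ (o a : K) (k : o < a) (x : 𝒜.Fib o) (ε : ℝ), 0 < ε →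
    ∀ᶠ g in 𝓝 (1 : G), ∃ k' : g • o ≤ a, ‖𝒜.incl k' (α.act g o x) - 𝒜.incl k.le x‖ < ε

/-- A `G`-covariant representation `(π, U, Γ)` of a `G`-covariant net on a family of Hilbert
spaces. All `π o` are unital. As in `CStarNet.Action`, the equal spaces over `h (g o)` and
`(h g) o` are identified by the inclusion operator, which is the identity. -/
structure CovariantRepresentation {𝒜 : CStarNet.{u, v} K} (α : 𝒜.Action G) (H : K → Type w)
    [∀ o, NormedAddCommGroup (H o)] [∀ o, InnerProductSpace ℂ (H o)]
    [∀ o, CompleteSpace (H o)] where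
  π : ∀ o, 𝒜.Fib o →⋆ₐ[ℂ] (H o →L[ℂ] H o)
  U : ∀ {o a : K}, o ≤ a → (H o ≃ₗᵢ[ℂ] H a)
  U_π : ∀ {o a : K} (k : o ≤ a) (x : 𝒜.Fib o) (ξ : H o),
    U k (π o x ξ) = π a (𝒜.incl k x) (U k ξ)
  U_comp : ∀ {o a e : K} (k₁ : o ≤ a) (k₂ : a ≤ e) (ξ : H o),
    U k₂ (U k₁ ξ) = U (k₁.trans k₂) ξ
  Γ : ∀ (g : G) (o : K), H o ≃ₗᵢ[ℂ] H (g • o)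
  Γ_mul : ∀ (h g : G) (o : K) (ξ : H o),
    U (mul_smul h g o).ge (Γ h (g • o) (Γ g o ξ)) = Γ (h * g) o ξ
  Γ_π : ∀ (g : G) (o : K) (x : 𝒜.Fib o) (ξ : H o),
    Γ g o (π o x ξ) = π (g • o) (α.act g o x) (Γ g o ξ)
  Γ_U : ∀ (g : G) {o a : K} (k : o ≤ a) (ξ : H o),
    Γ g a (U k ξ) = U (smul_mono_right g k) (Γ g o ξ)

/-- Strong continuity of `Γ`: for `a > o`, if `g` tends to `1` then eventually `g o ≤ a` and
`U_{a,go} Γ^g_o Ω` tends to `U_{ao} Ω`, for all vectors `Ω`. -/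
def CovariantRepresentation.IsStronglyContinuous [TopologicalSpace G] {𝒜 : CStarNet.{u, v} K}
    {α : 𝒜.Action G} {H : K → Type w}
    [∀ o, NormedAddCommGroup (H o)] [∀ o, InnerProductSpace ℂ (H o)]
    [∀ o, CompleteSpace (H o)] (R : CovariantRepresentation α H) : Prop :=
  ∀ (o a : K) (k : o < a) (Ω : H o) (ε : ℝ), 0 < ε →
    ∀ᶠ g in 𝓝 (1 : G), ∃ k' : g • o ≤ a, ‖R.U k' (R.Γ g o Ω) - R.U k.le Ω‖ < ε

end Covariance

end PosetNet

/-! The problem is moved to the enveloping net bundle, where all inclusion maps are invertible, and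
is solved there by an invariant state and the GNS construction.

The enveloping bundle is functorial: `(p, A) ↦ (g p, α^g A)` respects the defining relations and
preserves the maximal seminorm, so `G` acts on the bundle (`envelopingAction`) and the canonical
embedding is equivariant. A covariant representation of the bundle therefore restricts to one of the
net.

In a bundle, elements are transported along paths, and the transport depends only on the homotopy
class. The homotopy group thus acts on the fibre over the base point, which is nonzero by
nondegeneracy. Averaging a state of this fibre over the amenable homotopy group gives a loop
invariant state. Its transports to the other fibres do not depend on the paths used, so they form a
family `ρ` invariant under the inclusion maps (`exists_isInvariantFamily`). A second average,
`ρ'_o(x) = m(g ↦ ρ_{go}(α^g_o x))`, keeps this invariance because the action commutes with the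
inclusions, and right invariance of `m` makes it `G`-invariant (`exists_action_invariant`). The GNS
spaces of an invariant family are then linked by the unitaries `U` and `Γ`, whose relations hold on
the dense set of GNS vectors because they hold in the algebras. Unitaries along paths to a base
point put everything on one space.

For a topological group the mean exists only on bounded uniformly continuous functions, so `g ↦
ρ_{go}(α^g_o x)` has to be such a function. This follows once the action on the enveloping bundle is
continuous (`envelopingAction_isContinuous`). For a symbol `(p, A)`, continuity of the symmetry
controls the path and continuity of the action on the net controls `A`. The same continuity, with
`‖x‖` bounding the norm of the GNS vector of `x`, makes `Γ` strongly continuous.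

The means act on real functions, so states are handled through their real parts; complex functionals
appear only for GNS. -/

namespace PosetNet

/-! ### Order preserving symmetries acting on paths -/

section PathAction

variable {K : Type v} [PartialOrder K] {G : Type w} [Group G] [MulAction G K]
  [CovariantClass G K HSMul.hSMul LE.le]

namespace PosetPath

theorem smul_comp (g : G) {a e o : K} (q : PosetPath e o) (p : PosetPath a e) :
    (q.comp p).smul g = (q.smul g).comp (p.smul g) := by
  induction q with
  | single b => rfl
  | cons b q ih => simp [comp, smul, ih]

/-- The action of an order preserving symmetry on 2-simplices. -/
def _root_.PosetNet.TwoSimplex.smul (g : G) {x₀ x₁ x₂ : K} (c : TwoSimplex x₀ x₁ x₂) :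
    TwoSimplex (g • x₀) (g • x₁) (g • x₂) :=
  ⟨c.d₀.smul g, c.d₁.smul g, c.d₂.smul g, g • c.supp, smul_mono_right g c.d₀_le,
    smul_mono_right g c.d₁_le, smul_mono_right g c.d₂_le⟩

theorem Deform.smul (g : G) {a o : K} {p q : PosetPath a o} (h : Deform p q) :
    Deform (p.smul g) (q.smul g) := by
  induction h with
  | last c => exact Deform.last (c.smul g)
  | mid c p => exact Deform.mid (c.smul g) (p.smul g)
  | cons b _ ih => exact Deform.cons (b.smul g) ih

theorem Homotopic.smul (g : G) {a o : K} {p q : PosetPath a o} (h : Homotopic p q) :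
    Homotopic (p.smul g) (q.smul g) := by
  induction h with
  | rel _ _ h => exact Relation.EqvGen.rel _ _ (h.smul g)
  | refl _ => exact Homotopic.refl _
  | symm _ _ _ ih => exact ih.symm
  | trans _ _ _ _ _ ih₁ ih₂ => exact ih₁.trans ih₂

/-- Both composites bound 2-simplices supported on `b'.supp` with the same long face `d`. -/
theorem nerve_comp_single {x y x' y' : K} (b : OneSimplex x y) (b' : OneSimplex x' y')
    (hx : x ≤ x') (hy : y ≤ y') (hb : b.supp ≤ b'.supp) :
    Homotopic ((nerve hy).comp (single b)) ((single b').comp (nerve hx)) :=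
  let d : OneSimplex x y' := ⟨b'.supp, hx.trans b'.src_le, b'.tgt_le⟩
  Homotopic.trans
    (Relation.EqvGen.rel _ _ (Deform.last
      ⟨OneSimplex.nerve hy, d, b, b'.supp, b'.tgt_le, le_rfl, hb⟩))
    (Homotopic.symm (Relation.EqvGen.rel _ _ (Deform.last
      ⟨b', d, OneSimplex.nerve hx, b'.supp, le_rfl, le_rfl, b'.src_le⟩)))

theorem nerve_comp_cons {e x y e' x' y' : K} {b : OneSimplex x y} {b' : OneSimplex x' y'}
    {p : PosetPath e x} {p' : PosetPath e' x'} (he : e ≤ e') (hx : x ≤ x') (hy : y ≤ y')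
    (hb : b.supp ≤ b'.supp) (h : Homotopic ((nerve hx).comp p) (p'.comp (nerve he))) :
    Homotopic ((nerve hy).comp (cons b p)) ((cons b' p').comp (nerve he)) := by
  have h₁ := comp_congr_left (nerve_comp_single b b' hx hy hb) p
  rw [comp_assoc, comp_assoc] at h₁
  exact h₁.trans (comp_congr_right (single b') h)

/-- The points `h • g • o` and `(h * g) • o` are equal only propositionally, so the two paths have
different types. They are compared through nerve simplices, as in the composition law of
`CStarNet.Action`. -/
theorem nerve_comp_smul_smul (h g : G) {a o : K} (p : PosetPath a o) :
    Homotopic ((nerve (mul_smul h g o).ge).comp ((p.smul g).smul h))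
      ((p.smul (h * g)).comp (nerve (mul_smul h g a).ge)) := by
  induction p with
  | single b => exact nerve_comp_single _ _ _ _ (mul_smul h g b.supp).ge
  | cons b p ih => exact nerve_comp_cons _ _ _ (mul_smul h g b.supp).ge ih

theorem nerve_comp_one_smul {a o : K} (p : PosetPath a o) :
    Homotopic ((nerve (one_smul G o).ge).comp p)
      ((p.smul (1 : G)).comp (nerve (one_smul G a).ge)) := by
  induction p with
  | single b => exact nerve_comp_single _ _ _ _ (one_smul G b.supp).ge
  | cons b p ih => exact nerve_comp_cons _ _ _ (one_smul G b.supp).ge ih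

end PosetPath

end PathAction

/-! ### Parallel transport in a C⋆-net bundle -/

section Holonomy

variable {K : Type v} [PartialOrder K]

namespace CStarNet

theorem incl_refl (𝒜 : CStarNet.{u, v} K) {o : K} (x : 𝒜.Fib o) : 𝒜.incl (le_refl o) x = x :=
  𝒜.incl_injective le_rfl (𝒜.incl_comp le_rfl le_rfl x)

variable {ℬ : CStarNet.{u, v} K} (hℬ : ℬ.IsBundle)

namespace IsBundle

/-- The inclusion maps of a C⋆-net bundle as ⋆-isomorphisms. -/
noncomputable def inclEquiv {a o : K} (h : a ≤ o) : ℬ.Fib a ≃⋆ₐ[ℂ] ℬ.Fib o :=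
  StarAlgEquiv.ofBijective (ℬ.incl h) (hℬ h)

/-- The parallel transport of a C⋆-net bundle along a 1-simplex. -/
noncomputable def simplexHolonomy {a o : K} (b : OneSimplex a o) : ℬ.Fib a ≃⋆ₐ[ℂ] ℬ.Fib o :=
  (hℬ.inclEquiv b.src_le).trans (hℬ.inclEquiv b.tgt_le).symm

/-- The parallel transport of a C⋆-net bundle along a path. -/
noncomputable def holonomy {a : K} : {o : K} → PosetPath a o → ℬ.Fib a ≃⋆ₐ[ℂ] ℬ.Fib o
  | _, .single b => hℬ.simplexHolonomy b
  | _, .cons b p => (holonomy p).trans (hℬ.simplexHolonomy b)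

/-- Transport along `b` becomes trivial in any fibre above the support of `b`. As inclusions are
injective, homotopy invariance then reduces to comparing images over the support of a 2-simplex. -/
theorem incl_simplexHolonomy {a o s : K} (b : OneSimplex a o) (h : b.supp ≤ s) (x : ℬ.Fib a) :
    ℬ.incl (b.tgt_le.trans h) (hℬ.simplexHolonomy b x) = ℬ.incl (b.src_le.trans h) x := by
  rw [← ℬ.incl_comp b.tgt_le h, ← ℬ.incl_comp b.src_le h]
  exact congrArg _ ((hℬ.inclEquiv b.tgt_le).apply_symm_apply _)

theorem simplexHolonomy_comp {x₀ x₁ x₂ : K} (c : TwoSimplex x₀ x₁ x₂) (x : ℬ.Fib x₀) :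
    hℬ.simplexHolonomy c.d₀ (hℬ.simplexHolonomy c.d₂ x) = hℬ.simplexHolonomy c.d₁ x := by
  apply ℬ.incl_injective (c.d₁.tgt_le.trans c.d₁_le)
  rw [hℬ.incl_simplexHolonomy c.d₁ c.d₁_le, hℬ.incl_simplexHolonomy c.d₀ c.d₀_le,
    hℬ.incl_simplexHolonomy c.d₂ c.d₂_le]

theorem holonomy_comp {a e o : K} (q : PosetPath e o) (p : PosetPath a e) (x : ℬ.Fib a) :
    hℬ.holonomy (q.comp p) x = hℬ.holonomy q (hℬ.holonomy p x) := by
  induction q with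
  | single b => rfl
  | cons b q ih => exact congrArg (hℬ.simplexHolonomy b) ih

theorem holonomy_deform {a o : K} {p q : PosetPath a o} (h : p.Deform q) (x : ℬ.Fib a) :
    hℬ.holonomy p x = hℬ.holonomy q x := by
  induction h with
  | last c => exact hℬ.simplexHolonomy_comp c x
  | mid c p => exact hℬ.simplexHolonomy_comp c _
  | cons b _ ih => exact congrArg (hℬ.simplexHolonomy b) ih

theorem holonomy_homotopic {a o : K} {p q : PosetPath a o} (h : p.Homotopic q) (x : ℬ.Fib a) :
    hℬ.holonomy p x = hℬ.holonomy q x := by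
  induction h with
  | rel _ _ h => exact hℬ.holonomy_deform h x
  | refl _ => rfl
  | symm _ _ _ ih => exact ih.symm
  | trans _ _ _ _ _ ih₁ ih₂ => exact ih₁.trans ih₂

theorem holonomy_nerve {a o : K} (h : a ≤ o) (x : ℬ.Fib a) :
    hℬ.holonomy (PosetPath.nerve h) x = ℬ.incl h x := by
  rw [← ℬ.incl_refl (hℬ.holonomy (PosetPath.nerve h) x)]
  exact hℬ.incl_simplexHolonomy (OneSimplex.nerve h) le_rfl x

end IsBundle

end CStarNet

end Holonomy

/-! ### The action on the enveloping net bundle -/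

section EnvelopingAction

open PosetPath

variable {K : Type v} [PartialOrder K] {G : Type w} [Group G] [MulAction G K]
  [CovariantClass G K HSMul.hSMul LE.le] {𝒜 : CStarNet.{u, v} K} (α : 𝒜.Action G)

namespace CStarNet.Action

theorem incl_act_of_eq {g g' : G} (h : g = g') (o : K) (k : g • o ≤ g' • o) (x : 𝒜.Fib o) :
    𝒜.incl k (α.act g o x) = α.act g' o x := by
  subst h
  exact 𝒜.incl_refl _

theorem act_one (o : K) (x : 𝒜.Fib o) : α.act 1 o x = 𝒜.incl (one_smul G o).ge x := by
  -- No unit law is assumed. It follows by cancelling the injective `α.act 1` in the composition law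
  -- for `1 * 1`.
  refine (α.act 1 ((1 : G) • o)).injective ?_
  change α.act 1 ((1 : G) • o) _ = α.act 1 ((1 : G) • o) _
  apply 𝒜.incl_injective (mul_smul 1 1 o).ge
  rw [α.act_mul, α.act_incl, 𝒜.incl_comp, α.incl_act_of_eq (mul_one 1).symm]

theorem norm_act (g : G) (o : K) (x : 𝒜.Fib o) : ‖α.act g o x‖ = ‖x‖ :=
  NonUnitalStarAlgHom.norm_map (α.act g o) (α.act g o).injective x

end CStarNet.Action

namespace EnvAlg

theorem incl_refl {o : K} (x : EnvAlg 𝒜 o) : incl (le_refl o) x = x := transport_triv x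

theorem incl_symb {a e o : K} (h : e ≤ o) (p : PosetPath a e) (x : 𝒜.Fib a) :
    incl h (symb p x) = symb ((nerve h).comp p) x := transport_symb _ _ _

theorem incl_injective {a o : K} (h : a ≤ o) : Function.Injective (incl (𝒜 := 𝒜) h) :=
  Function.LeftInverse.injective (transport_rev (nerve h))

theorem starAlgHom_ext {o : K} {R : Type*} [Semiring R] [Algebra ℂ R] [Star R]
    {φ ψ : EnvAlg 𝒜 o →⋆ₐ[ℂ] R} (h : ∀ {a : K} (p : PosetPath a o) (x : 𝒜.Fib a),
      φ (symb p x) = ψ (symb p x)) (x : EnvAlg 𝒜 o) : φ x = ψ x := by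
  induction x using induction with
  | scalar c => rw [AlgHomClass.commutes, AlgHomClass.commutes]
  | symb p x => exact h p x
  | mul x y hx hy => rw [map_mul, map_mul, hx, hy]
  | add x y hx hy => rw [map_add, map_add, hx, hy]

/-- The ⋆-morphism `(p, A) ↦ (g p, α^g A)`. -/
def act (g : G) (o : K) : EnvAlg 𝒜 o →⋆ₐ[ℂ] EnvAlg 𝒜 (g • o) where
  toAlgHom := lift (fun p x => symb (p.smul g) (α.act g _ x))
    (fun p x y => by rw [map_mul, symb_mul]) (fun p x y => by rw [map_add, symb_add])
    (fun p c x => by rw [map_smul, symb_smul])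
    (fun p => by rw [map_one, symb_one])
    (fun h p x => by rw [α.act_incl, symb_isotony, smul_comp]; rfl)
    (fun h x => symb_homotopy (h.smul g) _)
  map_star' x := by
    simp only [AlgHom.toRingHom_eq_coe, RingHom.toMonoidHom_eq_coe, OneHom.toFun_eq_coe,
      MonoidHom.toOneHom_coe, MonoidHom.coe_coe, RingHom.coe_coe]
    induction x using induction with
    | scalar c => rw [star_algebraMap', AlgHom.commutes, AlgHom.commutes, star_algebraMap']
    | symb p x => rw [star_symb, lift_symb, lift_symb, star_symb, map_star]
    | mul x y hx hy => rw [star_mul', map_mul, map_mul, hx, hy, star_mul']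
    | add x y hx hy => rw [star_add', map_add, map_add, hx, hy, star_add']

theorem act_symb (g : G) {a o : K} (p : PosetPath a o) (x : 𝒜.Fib a) :
    act α g o (symb p x) = symb (p.smul g) (α.act g a x) :=
  lift_symb ..

theorem act_incl (g : G) {a o : K} (k : a ≤ o) (x : EnvAlg 𝒜 a) :
    act α g o (incl k x) = incl (smul_mono_right g k) (act α g a x) :=
  starAlgHom_ext (φ := (act α g o).comp (incl k))
    (ψ := (incl (smul_mono_right g k)).comp (act α g a)) (fun p x => by
      simp only [StarAlgHom.comp_apply, incl_symb, act_symb, smul_comp]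
      rfl) x

theorem act_mul (h g : G) (o : K) (x : EnvAlg 𝒜 o) :
    incl (mul_smul h g o).ge (act α h (g • o) (act α g o x)) = act α (h * g) o x :=
  starAlgHom_ext
    (φ := (incl (mul_smul h g o).ge).comp ((act α h (g • o)).comp (act α g o)))
    (ψ := act α (h * g) o) (fun p x => by
      simp only [StarAlgHom.comp_apply, incl_symb, act_symb]
      rw [symb_homotopy (nerve_comp_smul_smul h g p), ← symb_isotony, α.act_mul]) x

theorem act_one (o : K) (x : EnvAlg 𝒜 o) :
    act α 1 o x = incl (one_smul G o).ge x :=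
  starAlgHom_ext (φ := act α 1 o) (ψ := incl (one_smul G o).ge) (fun p x => by
    rw [incl_symb, act_symb, symb_homotopy (nerve_comp_one_smul (G := G) p), ← symb_isotony,
      α.act_one]) x

theorem act_eq_incl {k : G} (hk : k = 1) (o : K) (h : o ≤ k • o) (x : EnvAlg 𝒜 o) :
    act α k o x = incl h x := by
  subst hk
  exact act_one α o x

/-- A bundle `ℬ` pulled back along `g` is again a bundle `ℬ'`, and a morphism `π` into `ℬ` composed
with the action is a morphism into `ℬ'`. The norms at the image of `x` are thus among those whose
supremum is `‖x‖`. -/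
theorem norm_act_le (g : G) (o : K) (x : EnvAlg 𝒜 o) : ‖act α g o x‖ ≤ ‖x‖ :=
  envNorm_le (norm_nonneg _) fun ℬ hℬ π =>
    let ℬ' : CStarNet.{max u v, v} K :=
      { Fib := fun a => ℬ.Fib (g • a)
        incl := fun h => ℬ.incl (smul_mono_right g h)
        incl_injective := fun h => ℬ.incl_injective (smul_mono_right g h)
        incl_comp := fun h₁ h₂ => ℬ.incl_comp (smul_mono_right g h₁) (smul_mono_right g h₂) }
    let π' : EnvAlg.Hom 𝒜 ℬ' :=
      { app := fun a => (π.app (g • a)).comp (act α g a).toNonUnitalStarAlgHom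
        naturality := fun h y =>
          (congrArg (π.app _) (act_incl α g h y)).trans (π.naturality (smul_mono_right g h) _) }
    norm_app_le ℬ' (fun h => hℬ (smul_mono_right g h)) π' x

theorem norm_act (g : G) (o : K) (x : EnvAlg 𝒜 o) : ‖act α g o x‖ = ‖x‖ := by
  refine le_antisymm (norm_act_le α g o x) ?_
  calc ‖x‖ = ‖act α (g⁻¹ * g) o x‖ := by
        rw [act_eq_incl α (inv_mul_cancel g) o (by rw [inv_mul_cancel, one_smul]), norm_incl]
    _ = ‖act α g⁻¹ (g • o) (act α g o x)‖ := by rw [← act_mul, norm_incl]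
    _ ≤ ‖act α g o x‖ := norm_act_le α _ _ _

theorem act_surjective (g : G) (o : K) : Function.Surjective (act α g o) := fun y => by
  -- The preimage is `g⁻¹` applied to `y`, carried back from the fibre over `g⁻¹ • g • o` to the
  -- equal fibre over `o`.
  refine ⟨incl (inv_smul_smul g o).le (act α g⁻¹ (g • o) y), ?_⟩
  apply incl_injective (smul_inv_smul g (g • o)).ge
  rw [act_incl, incl_incl]
  apply incl_injective (mul_smul g g⁻¹ (g • o)).ge
  rw [incl_incl, incl_incl, ← act_eq_incl α (mul_inv_cancel g) (g • o), ← act_mul]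

end EnvAlg

open UniformSpace

/-- An isometry from a complete space has closed range, and this range contains a dense set. -/
theorem completionMap_bijective {A B : Type*} [SeminormedRing A] [StarRing A] [NormedAlgebra ℂ A]
    [StarModule ℂ A] [NormedStarGroup A] [SeminormedRing B] [StarRing B] [NormedAlgebra ℂ B]
    [StarModule ℂ B] [NormedStarGroup B] (f : A →⋆ₐ[ℂ] B) (hf : ∀ x, ‖f x‖ = ‖x‖)
    (hs : Function.Surjective f) : Function.Bijective (completionMap f hf) := by
  refine ⟨(completionMap_isometry f hf).injective, fun y => ?_⟩
  induction y using Completion.induction_on with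
  | hp => exact (completionMap_isometry f hf).isClosedEmbedding.isClosed_range
  | ih y =>
    obtain ⟨x, rfl⟩ := hs y
    exact ⟨x, completionMap_coe f hf x⟩

/-- The action on the enveloping net bundle induced by an action on a net. -/
noncomputable def envelopingAction : (envelopingNet 𝒜).Action G where
  act g o := StarAlgEquiv.ofBijective (completionMap (EnvAlg.act α g o) (EnvAlg.norm_act α g o))
    (completionMap_bijective _ _ (EnvAlg.act_surjective α g o))
  act_mul h g o x := by
    change completionMap _ (EnvAlg.norm_incl _) (completionMap _ (EnvAlg.norm_act α h _)
      (completionMap _ (EnvAlg.norm_act α g o) x)) = completionMap _ (EnvAlg.norm_act α (h * g) o) x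
    induction x using Completion.induction_on with
    | hp =>
      exact isClosed_eq ((completionMap_isometry _ _).continuous.comp
        ((completionMap_isometry _ _).continuous.comp (completionMap_isometry _ _).continuous))
        (completionMap_isometry _ _).continuous
    | ih x => simp only [completionMap_coe, EnvAlg.act_mul]
  act_incl g a o k x := by
    change completionMap _ (EnvAlg.norm_act α g o) (completionMap _ (EnvAlg.norm_incl k) x) =
      completionMap _ (EnvAlg.norm_incl _) (completionMap _ (EnvAlg.norm_act α g a) x)
    induction x using Completion.induction_on with
    | hp =>
      exact isClosed_eq
        ((completionMap_isometry _ _).continuous.comp (completionMap_isometry _ _).continuous)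
        ((completionMap_isometry _ _).continuous.comp (completionMap_isometry _ _).continuous)
    | ih x => simp only [completionMap_coe, EnvAlg.act_incl]

theorem envelopingAction_act_coe (g : G) (o : K) (x : EnvAlg 𝒜 o) :
    (envelopingAction α).act g o (x : Completion (EnvAlg 𝒜 o)) =
      (EnvAlg.act α g o x : Completion (EnvAlg 𝒜 (g • o))) :=
  completionMap_coe _ (EnvAlg.norm_act α g o) x

variable (𝒜) in
theorem canonicalEmbedding_one (o : K) : (canonicalEmbedding 𝒜).app o 1 = 1 :=
  congrArg (fun x : EnvAlg 𝒜 o => (x : Completion (EnvAlg 𝒜 o))) (EnvAlg.symb_one (triv o))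

variable (𝒜) in
/-- The canonical embedding in the enveloping net bundle as a unital ⋆-morphism. -/
noncomputable def canonicalStarAlgHom (o : K) : 𝒜.Fib o →⋆ₐ[ℂ] (envelopingNet 𝒜).Fib o where
  __ := (canonicalEmbedding 𝒜).app o
  map_one' := canonicalEmbedding_one 𝒜 o
  commutes' c := by
    change (canonicalEmbedding 𝒜).app o (algebraMap ℂ _ c) = _
    rw [Algebra.algebraMap_eq_smul_one, Algebra.algebraMap_eq_smul_one, map_smul,
      canonicalEmbedding_one]

theorem canonicalStarAlgHom_apply (o : K) (x : 𝒜.Fib o) :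
    canonicalStarAlgHom 𝒜 o x =
      (EnvAlg.symb (triv o) x : Completion (EnvAlg 𝒜 o)) :=
  rfl

theorem canonicalStarAlgHom_incl {a o : K} (h : a ≤ o) (x : 𝒜.Fib a) :
    canonicalStarAlgHom 𝒜 o (𝒜.incl h x) =
      (envelopingNet 𝒜).incl h (canonicalStarAlgHom 𝒜 a x) :=
  (canonicalEmbedding 𝒜).naturality h x

theorem canonicalStarAlgHom_act (g : G) (o : K) (x : 𝒜.Fib o) :
    canonicalStarAlgHom 𝒜 (g • o) (α.act g o x) =
      (envelopingAction α).act g o (canonicalStarAlgHom 𝒜 o x) := by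
  rw [canonicalStarAlgHom_apply, canonicalStarAlgHom_apply, envelopingAction_act_coe,
    EnvAlg.act_symb]
  rfl

/-! ### Continuity of the induced action -/

section Continuity

variable [TopologicalSpace G]

/-- The source of a symbol can be raised by first walking back along the nerve simplex. This brings
symbols with different sources over a common one. -/
theorem EnvAlg.symb_eq_incl {a e o : K} (h : a ≤ e) (p : PosetPath a o) (x : 𝒜.Fib a) :
    symb p x = symb (p.comp (nerve h).rev) (𝒜.incl h x) := by
  rw [symb_isotony, comp_assoc]
  exact (symb_homotopy ((comp_congr_right p (rev_comp (nerve h))).trans (comp_triv p)) x).symm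

theorem EnvAlg.symb_sub {a o : K} (p : PosetPath a o) (x y : 𝒜.Fib a) :
    symb p (x - y) = symb p x - symb p y :=
  map_sub (symbHom p) x y

/-- The approximation step of an `ε / 3` argument: estimates on a dense set extend to all of the
space when both maps are isometric. -/
theorem norm_sub_le_of_isometric {E F : Type*} [PseudoMetricSpace E] [SeminormedAddCommGroup F]
    {S T : E → F} (hS : Isometry S) (hT : Isometry T) (x y : E) :
    ‖S x - T x‖ ≤ dist x y + ‖S y - T y‖ + dist x y := by
  have h := dist_triangle4 (S x) (S y) (T y) (T x)
  rwa [hS.dist_eq, hT.dist_eq, dist_comm y x, dist_eq_norm, dist_eq_norm (S y)] at h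

theorem EnvAlg.norm_symb_le {a o : K} (p : PosetPath a o) (x : 𝒜.Fib a) :
    ‖symb p x‖ ≤ ‖x‖ :=
  envNorm_le (norm_nonneg _) fun _ _ π => NonUnitalStarAlgHom.norm_apply_le
    ((π.app o).comp (symbHom p).toNonUnitalStarAlgHom) x

theorem EnvAlg.act_continuous (hG : IsContinuousSymmetry K G) (hα : α.IsContinuous)
    (hK : NoMaxOrder K) {o a : K} (k : o < a) (x : EnvAlg 𝒜 o) (ε : ℝ) (hε : 0 < ε) :
    ∀ᶠ g in 𝓝 (1 : G), ∃ k' : g • o ≤ a, ‖incl k' (act α g o x) - incl k.le x‖ < ε := by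
  induction x using EnvAlg.induction generalizing ε with
  | scalar c =>
    -- Scalars are fixed by the action, so only `g • o ≤ a` is needed; continuity at the element `0`
    -- supplies it.
    filter_upwards [hα o a k 0 1 one_pos] with g ⟨k', _⟩
    exact ⟨k', by simpa only [AlgHomClass.commutes, sub_self, norm_zero] using hε⟩
  | @symb e p x =>
    -- Absence of maximal elements gives a point `e'` strictly above the source. With both sources
    -- raised to `e'`, the two paths are homotopic for `g` near `1`, and only the difference of the
    -- algebra elements over `e'` remains.
    obtain ⟨e', he⟩ := exists_gt e
    filter_upwards [hG e o p a e' k he, hα e e' he x ε hε] with g ⟨k₀, k₁, hg⟩ ⟨_, hx⟩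
    refine ⟨k₀, lt_of_le_of_lt ?_ hx⟩
    rw [act_symb, incl_symb, incl_symb, symb_eq_incl k₁, symb_eq_incl he.le (_ : PosetPath e a),
      symb_homotopy hg, ← symb_sub]
    exact norm_symb_le _ _
  | mul x y hx hy =>
    -- The summand `1` keeps the denominator positive when both norms vanish and makes the final
    -- inequality strict.
    have hd : 0 < ‖x‖ + ‖y‖ + 1 := by positivity
    filter_upwards [hx _ (div_pos hε hd), hy _ (div_pos hε hd)] with g ⟨k', h₁⟩ ⟨_, h₂⟩
    refine ⟨k', ?_⟩
    have h₃ : incl k' (act α g o (x * y)) - incl k.le (x * y) =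
        incl k' (act α g o x) * (incl k' (act α g o y) - incl k.le y) +
          (incl k' (act α g o x) - incl k.le x) * incl k.le y := by
      simp only [map_mul, mul_sub, sub_mul]; abel
    rw [h₃]
    calc _ ≤ ‖x‖ * (ε / (‖x‖ + ‖y‖ + 1)) + ε / (‖x‖ + ‖y‖ + 1) * ‖y‖ := by
          refine (norm_add_le _ _).trans (add_le_add ?_ ?_)
          · refine (norm_mul_le _ _).trans ?_
            rw [norm_incl, norm_act]
            gcongr
          · refine (norm_mul_le _ _).trans ?_
            rw [norm_incl]
            gcongr
      _ = ε * ((‖x‖ + ‖y‖) / (‖x‖ + ‖y‖ + 1)) := by ring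
      _ < ε * 1 := by
          gcongr
          rw [div_lt_one hd]
          exact lt_add_one _
      _ = ε := mul_one ε
  | add x y hx hy =>
    filter_upwards [hx _ (half_pos hε), hy _ (half_pos hε)] with g ⟨k', h₁⟩ ⟨_, h₂⟩
    refine ⟨k', ?_⟩
    rw [map_add, map_add, map_add, add_sub_add_comm]
    calc _ ≤ _ := norm_add_le _ _
      _ < ε / 2 + ε / 2 := add_lt_add h₁ h₂
      _ = ε := add_halves ε

theorem envelopingAction_isContinuous (hG : IsContinuousSymmetry K G) (hα : α.IsContinuous)
    (hK : NoMaxOrder K) : (envelopingAction α).IsContinuous := by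
  intro o a k x ε hε
  obtain ⟨y, hy⟩ := Metric.denseRange_iff.1 (Completion.denseRange_coe (α := EnvAlg 𝒜 o)) x (ε / 3)
    (div_pos hε three_pos)
  filter_upwards [EnvAlg.act_continuous α hG hα hK k y (ε / 3) (div_pos hε three_pos)] with g ⟨k', h⟩
  refine ⟨k', (norm_sub_le_of_isometric
    ((completionMap_isometry _ (EnvAlg.norm_incl k')).comp
      (completionMap_isometry _ (EnvAlg.norm_act α g o)))
    (completionMap_isometry _ (EnvAlg.norm_incl k.le)) x (y : Completion (EnvAlg 𝒜 o))).trans_lt ?_⟩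
  rw [Function.comp_apply, completionMap_coe, completionMap_coe, completionMap_coe,
    ← Completion.coe_sub, Completion.norm_coe]
  linarith

end Continuity

end EnvelopingAction

/-! ### Real parts of states -/

section RealStates

/-- The real parts of the states of a unital C⋆-algebra. -/
structure IsRealState {A : Type*} [CStarAlgebra A] (ρ : A →ₗ[ℝ] ℝ) : Prop where
  map_one : ρ 1 = 1
  nonneg : ∀ x, 0 ≤ ρ (star x * x)
  map_star : ∀ x, ρ (star x) = ρ x
  abs_le : ∀ x, |ρ x| ≤ ‖x‖

/-- For skew `k` the C⋆-identity gives `‖k + t‖ ^ 2 ≤ ‖k‖ ^ 2 + t ^ 2`. Comparison with `(ρ k + t) ^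
2` cancels `t ^ 2` and leaves a linear function of `t` bounded above on the whole line, so its slope
is zero. -/
theorem eq_zero_of_norm_le_one_of_skew {A : Type*} [CStarAlgebra A] [Nontrivial A] {ρ : A →ₗ[ℝ] ℝ}
    (h₁ : ρ 1 = 1) (hρ : ∀ x, |ρ x| ≤ ‖x‖) {k : A} (hk : star k = -k) : ρ k = 0 := by
  have key : ∀ t : ℝ, 2 * t * ρ k ≤ ‖k‖ ^ 2 := fun t => by
    have h₂ : ‖k + t • (1 : A)‖ ^ 2 ≤ ‖k‖ ^ 2 + t ^ 2 := by
      have h₃ : star (k + t • (1 : A)) * (k + t • (1 : A)) = (t ^ 2) • (1 : A) - k * k := by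
        rw [star_add, star_smul, star_one, hk, star_trivial]
        simp only [mul_add, add_mul, neg_mul, mul_smul_comm, smul_mul_assoc, mul_one, one_mul,
          smul_add, smul_neg, smul_smul, pow_two]
        abel
      rw [pow_two, ← CStarRing.norm_star_mul_self, h₃, add_comm]
      refine (norm_sub_le _ _).trans (add_le_add ?_ ?_)
      · rw [norm_smul, norm_one, mul_one, Real.norm_of_nonneg (sq_nonneg t)]
      · rw [pow_two]
        exact norm_mul_le _ _
    have h₄ : (ρ k + t) ^ 2 ≤ ‖k + t • (1 : A)‖ ^ 2 := by
      have h₅ := hρ (k + t • (1 : A))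
      rw [map_add, map_smul, h₁, smul_eq_mul, mul_one] at h₅
      exact sq_le_sq' (abs_le.1 h₅).1 (abs_le.1 h₅).2
    nlinarith [sq_nonneg (ρ k)]
  by_contra h
  -- This `t` makes the left side equal to `‖k‖ ^ 2 + 1`.
  have h' := key ((‖k‖ ^ 2 + 1) / (2 * ρ k))
  rw [show 2 * ((‖k‖ ^ 2 + 1) / (2 * ρ k)) * ρ k = ‖k‖ ^ 2 + 1 by field_simp] at h'
  linarith

theorem norm_smul_one_sub_le {A : Type*} [CStarAlgebra A] [Nontrivial A] (x : A) :
    ‖‖star x * x‖ • (1 : A) - star x * x‖ ≤ ‖star x * x‖ := by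
  let _ := CStarAlgebra.spectralOrder A
  let _ := CStarAlgebra.spectralOrderedRing A
  have h₁ : star x * x ≤ algebraMap ℝ A ‖star x * x‖ :=
    IsSelfAdjoint.le_algebraMap_norm_self (IsSelfAdjoint.star_mul_self x)
  have h₂ : (0 : A) ≤ star x * x := star_mul_self_nonneg x
  rw [← Algebra.algebraMap_eq_smul_one]
  exact (CStarAlgebra.norm_le_iff_le_algebraMap _ (norm_nonneg _) (sub_nonneg.2 h₁)).2
    (sub_le_self _ h₂)

/-- With `r = ‖star x * x‖`, the element `r • 1 - star x * x` has norm at most `r`, so `r - ρ (star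
x * x) ≤ r`. Invariance under the adjoint holds because `star x - x` is skew. -/
theorem isRealState_of_norm_le {A : Type*} [CStarAlgebra A] [Nontrivial A] {ρ : A →ₗ[ℝ] ℝ}
    (h₁ : ρ 1 = 1) (hρ : ∀ x, |ρ x| ≤ ‖x‖) : IsRealState ρ where
  map_one := h₁
  nonneg x := by
    have h := (le_abs_self _).trans ((hρ _).trans (norm_smul_one_sub_le x))
    rw [map_sub, map_smul, h₁, smul_eq_mul, mul_one] at h
    linarith
  map_star x := by
    have h := eq_zero_of_norm_le_one_of_skew h₁ hρ (k := star x - x) (by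
      rw [star_sub, star_star, neg_sub])
    rwa [map_sub, sub_eq_zero] at h
  abs_le := hρ

/-- Hahn–Banach: a norm one real functional attaining its norm at `1`. -/
theorem exists_isRealState (A : Type*) [CStarAlgebra A] [Nontrivial A] :
    ∃ ρ : A →ₗ[ℝ] ℝ, IsRealState ρ := by
  obtain ⟨f, hf, hf₁⟩ := exists_dual_vector ℝ (1 : A) (by rw [norm_one]; exact one_ne_zero)
  refine ⟨f.toLinearMap, isRealState_of_norm_le ?_ fun x => ?_⟩
  · exact hf₁.trans (by simp)
  · have h := f.le_opNorm x
    rwa [hf, one_mul] at h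

/-- The pullback of a real linear form along a complex linear map. -/
noncomputable def pullback {A B F : Type*} [CStarAlgebra A] [CStarAlgebra B] [FunLike F A B]
    [AlgHomClass F ℂ A B] (ρ : B →ₗ[ℝ] ℝ) (φ : F) : A →ₗ[ℝ] ℝ where
  toFun x := ρ (φ x)
  map_add' x y := by rw [map_add, map_add]
  map_smul' r x := by
    rw [← Complex.coe_smul, map_smul, Complex.coe_smul, map_smul, RingHom.id_apply]

theorem IsRealState.pullback {A B F : Type*} [CStarAlgebra A] [CStarAlgebra B] [FunLike F A B]
    [AlgHomClass F ℂ A B] [StarHomClass F A B] {ρ : B →ₗ[ℝ] ℝ} (hρ : IsRealState ρ) (φ : F) :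
    IsRealState (pullback ρ φ) where
  map_one := (congrArg ρ (_root_.map_one φ)).trans hρ.map_one
  nonneg x := by
    change 0 ≤ ρ (φ (star x * x))
    rw [map_mul, StarHomClass.map_star]
    exact hρ.nonneg (φ x)
  map_star x := (congrArg ρ (StarHomClass.map_star φ x)).trans (hρ.map_star (φ x))
  abs_le x := (hρ.abs_le (φ x)).trans (NonUnitalStarAlgHom.norm_apply_le φ x)

end RealStates

/-! ### Averaging linear forms by an invariant mean -/

section Averages

namespace IsRightInvariantMean

variable {G : Type*} [Group G] {S : Submodule ℝ (G → ℝ)} {m : (G → ℝ) → ℝ}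
  (hm : IsRightInvariantMean (S : Set (G → ℝ)) m)

include hm in
theorem mono (h₁ : 1 ∈ S) {f : G → ℝ} {C : ℝ} (hf : f ∈ S) (h : ∀ g, f g ≤ C) : m f ≤ C := by
  have h₂ := hm.nonneg (C • 1 + (-1 : ℝ) • f) (S.add_mem (S.smul_mem C h₁) (S.smul_mem _ hf))
    fun g => by simpa using h g
  rw [hm.map_add _ (S.smul_mem C h₁) _ (S.smul_mem _ hf), hm.map_smul _ _ h₁,
    hm.map_smul _ _ hf, hm.map_one] at h₂
  linarith

variable {A : Type*} [CStarAlgebra A] (ρ : G → A →ₗ[ℝ] ℝ) (hS : ∀ x, (fun g => ρ g x) ∈ S)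

/-- The average of a family of real linear forms. -/
noncomputable def average : A →ₗ[ℝ] ℝ where
  toFun x := m fun g => ρ g x
  map_add' x y := by
    rw [← hm.map_add _ (hS x) _ (hS y)]
    exact congrArg m (funext fun g => _root_.map_add (ρ g) x y)
  map_smul' c x := by
    refine Eq.trans ?_ (hm.map_smul c _ (hS x))
    exact congrArg m (funext fun g => _root_.map_smul (ρ g) c x)

theorem isRealState_average (h₁ : 1 ∈ S) (hρ : ∀ g, IsRealState (ρ g)) :
    IsRealState (hm.average ρ hS) where
  map_one := (congrArg m (funext fun g => (hρ g).map_one)).trans hm.map_one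
  nonneg x := hm.nonneg _ (hS _) fun g => (hρ g).nonneg x
  map_star x := congrArg m (funext fun g => (hρ g).map_star x)
  abs_le x := by
    refine abs_le'.2 ⟨hm.mono h₁ (hS x) fun g => (abs_le'.1 ((hρ g).abs_le x)).1, ?_⟩
    rw [← map_neg]
    refine hm.mono h₁ (hS (-x)) fun g => ?_
    rw [map_neg]
    exact (abs_le'.1 ((hρ g).abs_le x)).2

end IsRightInvariantMean

/-- The bounded real functions. -/
def boundedFunctions (G : Type*) : Submodule ℝ (G → ℝ) where
  carrier := {f | ∃ C, ∀ x, |f x| ≤ C}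
  zero_mem' := ⟨0, fun x => by simp⟩
  add_mem' := by
    rintro f f' ⟨C, hC⟩ ⟨C', hC'⟩
    exact ⟨C + C', fun x => (abs_add_le _ _).trans (add_le_add (hC x) (hC' x))⟩
  smul_mem' := by
    rintro c f ⟨C, hC⟩
    refine ⟨|c| * C, fun x => ?_⟩
    rw [Pi.smul_apply, smul_eq_mul, abs_mul]
    exact mul_le_mul_of_nonneg_left (hC x) (abs_nonneg c)

theorem one_mem_boundedFunctions (G : Type*) : 1 ∈ boundedFunctions G := ⟨1, fun x => by simp⟩

/-- The bounded uniformly continuous real functions on a group. -/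
def uniformlyContinuousFunctions (G : Type*) [Group G] [TopologicalSpace G] :
    Submodule ℝ (G → ℝ) where
  carrier := {f : G → ℝ | (∃ C, ∀ x, |f x| ≤ C) ∧
    ∀ ε > 0, ∀ᶠ v in 𝓝 (1 : G), ∀ x, |f (x * v) - f x| ≤ ε}
  zero_mem' := ⟨(boundedFunctions G).zero_mem, fun ε hε => by
    filter_upwards with v x using by simpa using hε.le⟩
  add_mem' := by
    rintro f f' ⟨hf, hf'⟩ ⟨hg, hg'⟩
    refine ⟨(boundedFunctions G).add_mem hf hg, fun ε hε => ?_⟩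
    filter_upwards [hf' _ (half_pos hε), hg' _ (half_pos hε)] with v h₁ h₂ x
    rw [Pi.add_apply, Pi.add_apply, add_sub_add_comm, ← add_halves ε]
    exact (abs_add_le _ _).trans (add_le_add (h₁ x) (h₂ x))
  smul_mem' := by
    rintro c f ⟨hf, hf'⟩
    refine ⟨(boundedFunctions G).smul_mem c hf, fun ε hε => ?_⟩
    -- Dividing by `|c| + 1` instead of `|c|` covers `c = 0`.
    have hc : 0 < |c| + 1 := by positivity
    filter_upwards [hf' _ (div_pos hε hc)] with v h₁ x
    rw [Pi.smul_apply, Pi.smul_apply, ← smul_sub, smul_eq_mul, abs_mul]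
    calc |c| * |f (x * v) - f x| ≤ (|c| + 1) * (ε / (|c| + 1)) :=
          mul_le_mul (by linarith) (h₁ x) (abs_nonneg _) hc.le
      _ = ε := mul_div_cancel₀ ε hc.ne'

theorem one_mem_uniformlyContinuousFunctions (G : Type*) [Group G] [TopologicalSpace G] :
    1 ∈ uniformlyContinuousFunctions G :=
  ⟨one_mem_boundedFunctions G, fun ε hε => by
    filter_upwards with v x using by simpa using hε.le⟩

end Averages

/-! ### Invariant families of states -/

section InvariantStates

variable {K : Type v} [PartialOrder K] {ℬ : CStarNet.{u, v} K}

/-- A family of real parts of states on the fibres which is invariant under the inclusion maps. -/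
structure CStarNet.IsInvariantFamily (ℬ : CStarNet.{u, v} K) (ρ : ∀ o, ℬ.Fib o →ₗ[ℝ] ℝ) : Prop where
  isRealState : ∀ o, IsRealState (ρ o)
  map_incl : ∀ {a o : K} (h : a ≤ o) (x : ℬ.Fib a), ρ o (ℬ.incl h x) = ρ a x

namespace CStarNet.IsBundle

variable (hℬ : ℬ.IsBundle)

/-- The parallel transport along the elements of the homotopy group. -/
noncomputable def loopHolonomy {o : K} (γ : HomotopyGroup o) : ℬ.Fib o ≃⋆ₐ[ℂ] ℬ.Fib o :=
  Quotient.lift hℬ.holonomy (fun _ _ h => StarAlgEquiv.ext (hℬ.holonomy_homotopic h)) γ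

theorem loopHolonomy_mul {o : K} (γ δ : HomotopyGroup o) (x : ℬ.Fib o) :
    hℬ.loopHolonomy (γ * δ) x = hℬ.loopHolonomy γ (hℬ.loopHolonomy δ x) := by
  induction γ using Quotient.ind with | _ p
  induction δ using Quotient.ind with | _ q
  exact hℬ.holonomy_comp p q x

include hℬ in
theorem exists_isInvariantFamily (hK : IsPathConnected K) {o₀ : K}
    (hπ : IsAmenable (HomotopyGroup o₀)) (h₀ : Nontrivial (ℬ.Fib o₀)) :
    ∃ ρ : ∀ o, ℬ.Fib o →ₗ[ℝ] ℝ, ℬ.IsInvariantFamily ρ := by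
  obtain ⟨m, hm⟩ := hπ
  obtain ⟨φ, hφ⟩ := exists_isRealState (ℬ.Fib o₀)
  change IsRightInvariantMean (boundedFunctions (HomotopyGroup o₀) : Set (HomotopyGroup o₀ → ℝ)) m
    at hm
  have hS : ∀ x, (fun γ => pullback φ (hℬ.loopHolonomy γ) x) ∈ boundedFunctions _ := fun x =>
    ⟨‖x‖, fun γ => (hφ.pullback (hℬ.loopHolonomy γ)).abs_le x⟩
  have hψ := hm.isRealState_average _ hS (one_mem_boundedFunctions _) fun γ => hφ.pullback _
  -- Transport along `p` before averaging replaces the function of `γ` by its right translate by the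
  -- class of `p`.
  have hinv : ∀ (p : PosetPath o₀ o₀) (x : ℬ.Fib o₀),
      hm.average _ hS (hℬ.holonomy p x) = hm.average _ hS x := fun p x => by
    refine Eq.trans ?_ (hm.map_right (Quotient.mk _ p) _ (hS x))
    exact congrArg m (funext fun γ => congrArg φ (hℬ.loopHolonomy_mul γ (Quotient.mk _ p) x).symm)
  have q : ∀ a, PosetPath a o₀ := fun a => (hK a o₀).some
  refine ⟨fun a => pullback (hm.average _ hS) (hℬ.holonomy (q a)), fun a => hψ.pullback _,
    fun {a o} h x => ?_⟩
  -- The chosen paths `q` need not be compatible with inclusions. The defect is transport around the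
  -- loop `q o * nerve h * (q a)⁻`, under which the averaged state is invariant.
  refine Eq.trans ?_ (hinv (((q o).comp (PosetPath.nerve h)).comp (q a).rev) _)
  refine congrArg (hm.average _ hS) ?_
  rw [← hℬ.holonomy_nerve, ← hℬ.holonomy_comp, ← hℬ.holonomy_comp, PosetPath.comp_assoc]
  exact (hℬ.holonomy_homotopic ((PosetPath.comp_congr_right _ (PosetPath.rev_comp _)).trans
    (PosetPath.comp_triv _)) x).symm

end CStarNet.IsBundle

variable {G : Type w} [Group G] [MulAction G K] [CovariantClass G K HSMul.hSMul LE.le]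
  (β : ℬ.Action G) {ρ : ∀ o, ℬ.Fib o →ₗ[ℝ] ℝ}

/-- An invariant family of real parts of states which is also invariant under a group action. -/
structure CStarNet.Action.IsInvariantFamily (ρ : ∀ o, ℬ.Fib o →ₗ[ℝ] ℝ) : Prop extends
    ℬ.IsInvariantFamily ρ where
  map_act : ∀ (g : G) (o : K) (x : ℬ.Fib o), ρ (g • o) (β.act g o x) = ρ o x

namespace CStarNet.IsInvariantFamily

variable (hρ : ℬ.IsInvariantFamily ρ)

include hρ in
-- The space `S` is left open so that one argument serves both the bounded and the uniformly
-- continuous functions.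
theorem exists_action_invariant {S : Submodule ℝ (G → ℝ)} {m : (G → ℝ) → ℝ}
    (hm : IsRightInvariantMean (S : Set (G → ℝ)) m) (h₁ : 1 ∈ S)
    (hS : ∀ (o : K) (x : ℬ.Fib o), (fun g : G => ρ (g • o) (β.act g o x)) ∈ S) :
    ∃ ρ' : ∀ o, ℬ.Fib o →ₗ[ℝ] ℝ, β.IsInvariantFamily ρ' := by
  refine ⟨fun o => hm.average (fun g => pullback (ρ (g • o)) (β.act g o)) (hS o),
    ⟨fun o => hm.isRealState_average _ _ h₁ fun g => (hρ.isRealState _).pullback _,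
      fun {a o} h x => ?_⟩, fun h o x => ?_⟩
  · refine congrArg m (funext fun g => ?_)
    change ρ (g • o) (β.act g o (ℬ.incl h x)) = ρ (g • a) (β.act g a x)
    rw [β.act_incl, hρ.map_incl]
  · refine Eq.trans ?_ (hm.map_right h _ (hS o x))
    refine congrArg m (funext fun g => ?_)
    change ρ (g • h • o) (β.act g (h • o) (β.act h o x)) = ρ ((g * h) • o) (β.act (g * h) o x)
    rw [← β.act_mul, hρ.map_incl]

include hρ in
theorem mem_boundedFunctions (o : K) (x : ℬ.Fib o) :
    (fun g : G => ρ (g • o) (β.act g o x)) ∈ boundedFunctions G :=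
  ⟨‖x‖, fun g => ((hρ.isRealState _).abs_le _).trans (β.norm_act g o x).le⟩

include hρ in
-- By invariance under inclusions, the values at `g * v` and at `g` can both be computed over `g •
-- a`. There the arguments differ by the image under `β.act g` of an element independent of `g`; the
-- action is isometric, so the estimate is uniform in `g`.
theorem mem_uniformlyContinuousFunctions [TopologicalSpace G] (hβ : β.IsContinuous)
    (hK : NoMaxOrder K) (o : K) (x : ℬ.Fib o) :
    (fun g : G => ρ (g • o) (β.act g o x)) ∈ uniformlyContinuousFunctions G := by
  refine ⟨hρ.mem_boundedFunctions β o x, fun ε hε => ?_⟩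
  obtain ⟨a, k⟩ := exists_gt o
  filter_upwards [hβ o a k x ε hε] with v ⟨k', hv⟩ g
  have h₁ : ρ ((g * v) • o) (β.act (g * v) o x) =
      ρ (g • a) (β.act g a (ℬ.incl k' (β.act v o x))) := by
    rw [β.act_incl, hρ.map_incl, ← β.act_mul, hρ.map_incl]
  have h₂ : ρ (g • o) (β.act g o x) = ρ (g • a) (β.act g a (ℬ.incl k.le x)) := by
    rw [β.act_incl, hρ.map_incl]
  rw [h₁, h₂, ← map_sub, ← map_sub]
  refine ((hρ.isRealState _).abs_le _).trans ?_
  rw [β.norm_act]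
  exact hv.le

end CStarNet.IsInvariantFamily

end InvariantStates

/-! ### GNS spaces and the unitaries between them -/

section GNS

open UniformSpace
open scoped ComplexOrder

variable {A B : Type*} [CStarAlgebra A] [PartialOrder A] [StarOrderedRing A]
  [CStarAlgebra B] [PartialOrder B] [StarOrderedRing B]

/-- The state with a given real part. -/
noncomputable def IsRealState.functional {ρ : A →ₗ[ℝ] ℝ} (hρ : IsRealState ρ) : A →ₚ[ℂ] ℂ :=
  PositiveLinearMap.mk₀ (Module.Dual.extendRCLike (𝕜 := ℂ) ρ) fun x hx => by
    obtain ⟨y, rfl⟩ := CStarAlgebra.nonneg_iff_eq_star_mul_self.1 hx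
    -- The element `I • (star y * y)` is skew, so invariance under the adjoint forces the imaginary
    -- part of the extension to vanish on positive elements.
    have h : ρ (Complex.I • (star y * y)) = 0 := by
      have h' := hρ.map_star (Complex.I • (star y * y))
      rw [star_smul, star_mul, star_star, Complex.star_def, Complex.conj_I, neg_smul, map_neg] at h'
      linarith
    rw [Module.Dual.extendRCLike_apply]
    change (0 : ℂ) ≤ (ρ (star y * y) : ℂ) - Complex.I * (ρ (Complex.I • (star y * y)) : ℂ)
    rw [h, Complex.ofReal_zero, mul_zero, sub_zero]
    exact Complex.zero_le_real.2 (hρ.nonneg y)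

theorem IsRealState.functional_apply {ρ : A →ₗ[ℝ] ℝ} (hρ : IsRealState ρ) (x : A) :
    hρ.functional x = ρ x - Complex.I * ρ (Complex.I • x) :=
  Module.Dual.extendRCLike_apply ρ x

theorem IsRealState.re_functional {ρ : A →ₗ[ℝ] ℝ} (hρ : IsRealState ρ) (x : A) :
    (hρ.functional x).re = ρ x := by
  rw [hρ.functional_apply]
  simp

/-- A complex linear functional is determined by its real part, so intertwining the real parts is
enough. -/
theorem IsRealState.functional_map {ρ : A →ₗ[ℝ] ℝ} (hρ : IsRealState ρ) {σ : B →ₗ[ℝ] ℝ}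
    (hσ : IsRealState σ) (φ : A ≃⋆ₐ[ℂ] B) (h : ∀ x, σ (φ x) = ρ x) (x : A) :
    hσ.functional (φ x) = hρ.functional x := by
  rw [hσ.functional_apply, hρ.functional_apply, ← map_smul, h, h]

/-- The vector of the GNS space attached to an element of the algebra. -/
noncomputable def gnsVector (f : A →ₚ[ℂ] ℂ) (x : A) : f.GNS := (f.toPreGNS x : Completion f.PreGNS)

theorem denseRange_gnsVector (f : A →ₚ[ℂ] ℂ) : DenseRange (gnsVector f) :=
  Completion.denseRange_coe (α := f.PreGNS)

theorem gnsVector_sub (f : A →ₚ[ℂ] ℂ) (x y : A) :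
    gnsVector f (x - y) = gnsVector f x - gnsVector f y :=
  (congrArg _ (map_sub f.toPreGNS x y)).trans (Completion.coe_sub _ _)

theorem norm_gnsVector (f : A →ₚ[ℂ] ℂ) (x : A) : ‖gnsVector f x‖ = √(f (star x * x)).re :=
  (Completion.norm_coe _).trans (f.preGNS_norm_def _)

theorem IsRealState.norm_gnsVector {ρ : A →ₗ[ℝ] ℝ} (hρ : IsRealState ρ) (x : A) :
    ‖gnsVector hρ.functional x‖ = √(ρ (star x * x)) := by
  rw [PosetNet.norm_gnsVector, hρ.re_functional]

theorem IsRealState.norm_gnsVector_le {ρ : A →ₗ[ℝ] ℝ} (hρ : IsRealState ρ) (x : A) :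
    ‖gnsVector hρ.functional x‖ ≤ ‖x‖ := by
  rw [hρ.norm_gnsVector, ← Real.sqrt_sq (norm_nonneg x), pow_two, ← CStarRing.norm_star_mul_self]
  exact Real.sqrt_le_sqrt ((le_abs_self _).trans (hρ.abs_le _))

theorem IsRealState.nontrivial_gns {ρ : A →ₗ[ℝ] ℝ} (hρ : IsRealState ρ) :
    Nontrivial hρ.functional.GNS :=
  ⟨gnsVector hρ.functional 1, 0, by
    rw [← norm_ne_zero_iff, hρ.norm_gnsVector, star_one, mul_one, hρ.map_one, Real.sqrt_one]
    exact one_ne_zero⟩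

theorem gnsStarAlgHom_gnsVector (f : A →ₚ[ℂ] ℂ) (x y : A) :
    f.gnsStarAlgHom x (gnsVector f y) = gnsVector f (x * y) :=
  f.gnsNonUnitalStarAlgHom_apply_coe

variable {f : A →ₚ[ℂ] ℂ} {f' : B →ₚ[ℂ] ℂ}

/-- The isometry of pre-GNS spaces induced by a ⋆-isomorphism which intertwines two functionals. -/
noncomputable def preGNSMap (φ : A ≃⋆ₐ[ℂ] B) (h : ∀ x, f' (φ x) = f x) :
    f.PreGNS →ₗᵢ[ℂ] f'.PreGNS where
  toFun x := f'.toPreGNS (φ (f.ofPreGNS x))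
  map_add' x y := by rw [map_add, map_add, map_add]
  map_smul' c x := by rw [map_smul, map_smul, map_smul, RingHom.id_apply]
  norm_map' x := by
    change ‖f'.toPreGNS (φ (f.ofPreGNS x))‖ = ‖x‖
    rw [f'.preGNS_norm_def, f.preGNS_norm_def, f'.ofPreGNS_toPreGNS, ← map_star, ← map_mul, h]

/-- The unitary of GNS spaces induced by a ⋆-isomorphism which intertwines two functionals. -/
noncomputable def gnsEquiv (φ : A ≃⋆ₐ[ℂ] B) (h : ∀ x, f' (φ x) = f x) : f.GNS ≃ₗᵢ[ℂ] f'.GNS :=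
  have hi : Isometry (preGNSMap φ h).toContinuousLinearMap.completion :=
    (preGNSMap φ h).isometry.completion_map
  LinearIsometryEquiv.ofSurjective
    { toLinearMap := (preGNSMap φ h).toContinuousLinearMap.completion.toLinearMap
      norm_map' := (AddMonoidHomClass.isometry_iff_norm _).1 hi } fun y => by
    induction y using Completion.induction_on with
    | hp => exact hi.isClosedEmbedding.isClosed_range
    | ih y =>
      refine ⟨gnsVector f (φ.symm (f'.ofPreGNS y)), ?_⟩
      refine ((preGNSMap φ h).toContinuousLinearMap.completion_apply_coe _).trans ?_
      exact congrArg _ (congrArg f'.toPreGNS (φ.apply_symm_apply _))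

theorem gnsEquiv_gnsVector (φ : A ≃⋆ₐ[ℂ] B) (h : ∀ x, f' (φ x) = f x) (x : A) :
    gnsEquiv φ h (gnsVector f x) = gnsVector f' (φ x) :=
  (preGNSMap φ h).toContinuousLinearMap.completion_apply_coe _

/-- Reduces each identity between operators on GNS spaces to one in the algebras. -/
theorem gns_ext {E : Type*} [TopologicalSpace E] [T2Space E] {S T : f.GNS → E} (hS : Continuous S)
    (hT : Continuous T) (h : ∀ x, S (gnsVector f x) = T (gnsVector f x)) (ξ : f.GNS) : S ξ = T ξ :=
  congrFun ((denseRange_gnsVector f).equalizer hS hT (funext h)) ξ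

theorem gnsEquiv_gnsStarAlgHom (φ : A ≃⋆ₐ[ℂ] B) (h : ∀ x, f' (φ x) = f x) (x : A) (ξ : f.GNS) :
    gnsEquiv φ h (f.gnsStarAlgHom x ξ) = f'.gnsStarAlgHom (φ x) (gnsEquiv φ h ξ) :=
  gns_ext ((gnsEquiv φ h).continuous.comp (f.gnsStarAlgHom x).continuous)
    ((f'.gnsStarAlgHom (φ x)).continuous.comp (gnsEquiv φ h).continuous) (fun y => by
      rw [Function.comp_apply, Function.comp_apply, gnsStarAlgHom_gnsVector, gnsEquiv_gnsVector,
        gnsEquiv_gnsVector, gnsStarAlgHom_gnsVector, map_mul]) ξ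

end GNS

/-! ### Covariant representations from invariant states -/

section Representations

variable {K : Type v} [PartialOrder K]

/-- Positive functionals and their GNS spaces require an order on the fibres; it is the spectral
one. -/
noncomputable instance (ℬ : CStarNet.{u, v} K) (o : K) : PartialOrder (ℬ.Fib o) :=
  CStarAlgebra.spectralOrder _

noncomputable instance (ℬ : CStarNet.{u, v} K) (o : K) : StarOrderedRing (ℬ.Fib o) :=
  CStarAlgebra.spectralOrderedRing _

variable {G : Type w} [Group G] [MulAction G K] [CovariantClass G K HSMul.hSMul LE.le]

namespace CStarNet.IsBundle

variable {ℬ : CStarNet.{u, v} K} (hℬ : ℬ.IsBundle) {β : ℬ.Action G}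
  {ρ : ∀ o, ℬ.Fib o →ₗ[ℝ] ℝ} (hρ : β.IsInvariantFamily ρ)

include hρ in
theorem map_inclEquiv {o a : K} (k : o ≤ a) (x : ℬ.Fib o) : ρ a (hℬ.inclEquiv k x) = ρ o x :=
  hρ.map_incl k x

/-- The GNS representation of a covariant C⋆-net bundle in an invariant family of states. -/
noncomputable def gnsRepresentation :
    CovariantRepresentation β (fun o => (hρ.isRealState o).functional.GNS) where
  π o := (hρ.isRealState o).functional.gnsStarAlgHom
  U {o a} k := gnsEquiv (hℬ.inclEquiv k)
    ((hρ.isRealState o).functional_map (hρ.isRealState a) _ (hℬ.map_inclEquiv hρ k))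
  U_π k x ξ := gnsEquiv_gnsStarAlgHom _ _ x ξ
  U_comp k₁ k₂ ξ := gns_ext ((LinearIsometryEquiv.continuous _).comp
      (LinearIsometryEquiv.continuous _)) (LinearIsometryEquiv.continuous _) (fun x => by
    simp only [Function.comp_apply, gnsEquiv_gnsVector]
    exact congrArg _ (ℬ.incl_comp k₁ k₂ x)) ξ
  Γ g o := gnsEquiv (β.act g o)
    ((hρ.isRealState o).functional_map (hρ.isRealState (g • o)) _ (hρ.map_act g o))
  Γ_mul h g o ξ := gns_ext ((LinearIsometryEquiv.continuous _).comp
      ((LinearIsometryEquiv.continuous _).comp (LinearIsometryEquiv.continuous _)))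
      (LinearIsometryEquiv.continuous _) (fun x => by
    simp only [Function.comp_apply, gnsEquiv_gnsVector]
    exact congrArg _ (β.act_mul h g o x)) ξ
  Γ_π g o x ξ := gnsEquiv_gnsStarAlgHom _ _ x ξ
  Γ_U g {o a} k ξ := gns_ext ((LinearIsometryEquiv.continuous _).comp
      (LinearIsometryEquiv.continuous _)) ((LinearIsometryEquiv.continuous _).comp
      (LinearIsometryEquiv.continuous _)) (fun x => by
    simp only [Function.comp_apply, gnsEquiv_gnsVector]
    exact congrArg _ (β.act_incl g k x)) ξ

/-- On a GNS vector, the difference of the two operators is the GNS vector of `incl (β^g x) - incl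
x`, bounded by the norm of that element. Density of these vectors and isometry do the rest. -/
theorem gnsRepresentation_isStronglyContinuous [TopologicalSpace G] (hβ : β.IsContinuous) :
    (hℬ.gnsRepresentation hρ).IsStronglyContinuous := by
  intro o a k Ω ε hε
  obtain ⟨x, hx⟩ := Metric.denseRange_iff.1 (denseRange_gnsVector (hρ.isRealState o).functional)
    Ω (ε / 3) (div_pos hε three_pos)
  filter_upwards [hβ o a k x (ε / 3) (div_pos hε three_pos)] with g ⟨k', h⟩
  refine ⟨k', (norm_sub_le_of_isometric
    (((hℬ.gnsRepresentation hρ).U k').isometry.comp ((hℬ.gnsRepresentation hρ).Γ g o).isometry)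
    ((hℬ.gnsRepresentation hρ).U k.le).isometry Ω
    (gnsVector (hρ.isRealState o).functional x)).trans_lt ?_⟩
  have h₁ : (hℬ.gnsRepresentation hρ).U k' ((hℬ.gnsRepresentation hρ).Γ g o
      (gnsVector (hρ.isRealState o).functional x)) =
      gnsVector (hρ.isRealState a).functional (ℬ.incl k' (β.act g o x)) :=
    (congrArg _ (gnsEquiv_gnsVector _ _ x)).trans (gnsEquiv_gnsVector _ _ _)
  have h₂ : (hℬ.gnsRepresentation hρ).U k.le (gnsVector (hρ.isRealState o).functional x) =
      gnsVector (hρ.isRealState a).functional (ℬ.incl k.le x) :=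
    gnsEquiv_gnsVector _ _ x
  rw [Function.comp_apply, h₁, h₂, ← gnsVector_sub]
  have h₃ := (hρ.isRealState a).norm_gnsVector_le (ℬ.incl k' (β.act g o x) - ℬ.incl k.le x)
  linarith

end CStarNet.IsBundle

namespace CovariantRepresentation

variable {𝒜 : CStarNet.{u, v} K} {α : 𝒜.Action G} {H : K → Type*}
  [∀ o, NormedAddCommGroup (H o)] [∀ o, InnerProductSpace ℂ (H o)] [∀ o, CompleteSpace (H o)]

/-- The restriction of a covariant representation of the enveloping net bundle. -/
noncomputable def restrict (R : CovariantRepresentation (envelopingAction α) H) :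
    CovariantRepresentation α H where
  π o := (R.π o).comp (canonicalStarAlgHom 𝒜 o)
  U := R.U
  U_π k x ξ := by
    rw [StarAlgHom.comp_apply, StarAlgHom.comp_apply, R.U_π, canonicalStarAlgHom_incl]
  U_comp := R.U_comp
  Γ := R.Γ
  Γ_mul := R.Γ_mul
  Γ_π g o x ξ := by
    rw [StarAlgHom.comp_apply, StarAlgHom.comp_apply, R.Γ_π, canonicalStarAlgHom_act]
  Γ_U := R.Γ_U

/-- A covariant representation is transported along a family of unitaries. -/
noncomputable def conj {H' : K → Type*} [∀ o, NormedAddCommGroup (H' o)]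
    [∀ o, InnerProductSpace ℂ (H' o)] [∀ o, CompleteSpace (H' o)]
    (R : CovariantRepresentation α H) (V : ∀ o, H o ≃ₗᵢ[ℂ] H' o) :
    CovariantRepresentation α H' where
  π o := (V o).conjStarAlgEquiv.toStarAlgHom.comp (R.π o)
  U {o a} k := ((V o).symm.trans (R.U k)).trans (V a)
  U_π k x ξ := by
    simp [R.U_π]
  U_comp k₁ k₂ ξ := by simp [R.U_comp]
  Γ g o := ((V o).symm.trans (R.Γ g o)).trans (V (g • o))
  Γ_mul h g o ξ := by simp [R.Γ_mul]
  Γ_π g o x ξ := by simp [R.Γ_π]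
  Γ_U g {o a} k ξ := by simp [R.Γ_U]

theorem conj_isStronglyContinuous [TopologicalSpace G] {H' : K → Type*}
    [∀ o, NormedAddCommGroup (H' o)] [∀ o, InnerProductSpace ℂ (H' o)] [∀ o, CompleteSpace (H' o)]
    {R : CovariantRepresentation α H} (hR : R.IsStronglyContinuous) (V : ∀ o, H o ≃ₗᵢ[ℂ] H' o) :
    (R.conj V).IsStronglyContinuous := by
  intro o a k Ω ε hε
  filter_upwards [hR o a k ((V o).symm Ω) ε hε] with g ⟨k', h⟩
  refine ⟨k', ?_⟩
  simpa [conj, ← map_sub] using h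

/-- The parallel transport of a representation along a path. -/
noncomputable def pathEquiv (R : CovariantRepresentation α H) {a : K} :
    {o : K} → PosetPath a o → (H a ≃ₗᵢ[ℂ] H o)
  | _, .single b => (R.U b.src_le).trans (R.U b.tgt_le).symm
  | _, .cons b p => (pathEquiv R p).trans ((R.U b.src_le).trans (R.U b.tgt_le).symm)

end CovariantRepresentation

theorem CStarNet.IsBundle.nontrivial {ℬ : CStarNet.{u, v} K} (hℬ : ℬ.IsBundle)
    (hK : IsPathConnected K) {a : K} (h : Nontrivial (ℬ.Fib a)) (o : K) : Nontrivial (ℬ.Fib o) :=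
  (hℬ.holonomy (hK a o).some).injective.nontrivial

/-- Conjugation by any family of unitaries preserves the covariance relations and strong continuity,
so arbitrary paths to `o₀` serve to identify all spaces with the one over `o₀`. -/
theorem exists_covariantRepresentation (hK : IsPathConnected K) (o₀ : K) {𝒜 : CStarNet.{u, v} K}
    {α : 𝒜.Action G} {ρ : ∀ o, (envelopingNet 𝒜).Fib o →ₗ[ℝ] ℝ}
    (hρ : (envelopingAction α).IsInvariantFamily ρ) :
    ∃ (H : Type (max u v)) (_ : NormedAddCommGroup H) (_ : InnerProductSpace ℂ H)
      (_ : CompleteSpace H), Nontrivial H ∧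
      ∃ R : CovariantRepresentation α (fun _ : K => H),
        ∀ [TopologicalSpace G], (envelopingAction α).IsContinuous → R.IsStronglyContinuous :=
  have hℬ : (envelopingNet 𝒜).IsBundle := envelopingNet_isBundle 𝒜
  let R := (hℬ.gnsRepresentation hρ).restrict
  ⟨(hρ.isRealState o₀).functional.GNS, inferInstance, inferInstance, inferInstance,
    (hρ.isRealState o₀).nontrivial_gns, R.conj fun o => R.pathEquiv (hK o o₀).some, fun hβ =>
      R.conj_isStronglyContinuous
        (hℬ.gnsRepresentation_isStronglyContinuous hρ hβ) _⟩

end Representations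

end PosetNet

open PosetNet in
theorem mainTheorem8 {K : Type v} [PartialOrder K] (hK : IsPathConnected K)
    (o₀ : K) (hπ : IsAmenable (HomotopyGroup o₀))
    {G : Type w} [Group G] [MulAction G K] [CovariantClass G K HSMul.hSMul LE.le]
    (𝒜 : CStarNet.{u, v} K) (α : 𝒜.Action G) (h𝒜 : 𝒜.IsInjective) :
    (IsAmenable G →
      ∃ (H : Type (max u v)) (_ : NormedAddCommGroup H) (_ : InnerProductSpace ℂ H)
        (_ : CompleteSpace H),
        Nontrivial H ∧ Nonempty (CovariantRepresentation α (fun _ : K => H))) ∧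
    (∀ [TopologicalSpace G] [IsTopologicalGroup G], IsTopologicallyAmenable G →
      NoMaxOrder K → IsContinuousSymmetry K G → α.IsContinuous →
      ∃ (H : Type (max u v)) (_ : NormedAddCommGroup H) (_ : InnerProductSpace ℂ H)
        (_ : CompleteSpace H),
        Nontrivial H ∧ ∃ R : CovariantRepresentation α (fun _ : K => H),
          R.IsStronglyContinuous) := by
  have hℬ : (envelopingNet 𝒜).IsBundle := envelopingNet_isBundle 𝒜
  obtain ⟨o₁, h₁⟩ := h𝒜.1
  -- Nondegeneracy gives a nonzero fibre over some `o₁`; transport along a path makes the fibre over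
  -- `o₀` nonzero too.
  obtain ⟨ρ, hρ⟩ := hℬ.exists_isInvariantFamily hK hπ (hℬ.nontrivial hK h₁ o₀)
  refine ⟨?_, ?_⟩
  · rintro ⟨m, hm⟩
    obtain ⟨ρ', hρ'⟩ := hρ.exists_action_invariant (envelopingAction α)
      (S := boundedFunctions G) hm (one_mem_boundedFunctions G) (hρ.mem_boundedFunctions _)
    obtain ⟨H, i₁, i₂, i₃, hH, R, -⟩ := exists_covariantRepresentation hK o₀ hρ'
    exact ⟨H, i₁, i₂, i₃, hH, ⟨R⟩⟩
  · rintro _ _ ⟨m, hm⟩ hmax hG hα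
    have hβ := envelopingAction_isContinuous α hG hα hmax
    obtain ⟨ρ', hρ'⟩ := hρ.exists_action_invariant (envelopingAction α)
      (S := uniformlyContinuousFunctions G) hm (one_mem_uniformlyContinuousFunctions G)
      (hρ.mem_uniformlyContinuousFunctions _ hβ hmax)
    obtain ⟨H, i₁, i₂, i₃, hH, R, hR⟩ := exists_covariantRepresentation hK o₀ hρ'
    exact ⟨H, i₁, i₂, i₃, hH, R, hR hβ⟩
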